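/- Let $n\ge 1$. A \emph{standard hyper curve} in $\mathbb R^n\times\mathbb R^n$ is a set $\Gamma=\bigcup_{i=1}^r\Gamma_i$, $r\ge 1$, where $\Gamma_i=\{(x,\gamma_i(x)):x\in\mathcal D_i\}$ for maps $\gamma_i:\mathcal D_i\to\mathbb R^n$ on closed domains $\mathcal D_i\subset\mathbb R^n$ (closures of nonempty connected open sets) such that: each $\gamma_i$ is differentiable with nonvanishing Jacobian determinant in the interior of $\mathcal D_i$; for $i\ne i'$ the equation $\gamma_i(x)=\gamma_{i'}(x)$ has at most finitely many solutions $x\in\mathcal D_i\cap\mathcal D_{i'}$; and there is $c_\gamma>1$ such that every $\gamma_i$ is injective on $\mathcal D_i$ and both $\gamma_i$ and $\gamma_i^{-1}:\gamma_i(\mathcal D_i)\to\mathcal D_i$ are Lipschitz with constant $c_\gamma$. For $E\subset\mathbb R^n$ put $\gamma^{-1}(E)=\bigcup_i\{x\in\mathcal D_i:\gamma_i(x)\in E\}$, and let $\rho(x,y)$ be the minimum over $i$ of the Euclidean distances from $(x,y)$ to $\Gamma_i$. A continuous linear operator $T:C_c^\infty(\mathbb R^n)\to\mathcal D'(\mathbb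 R^n)$ belongs to $CZO_\gamma$ if it extends to a bounded operator on $L^2(\mathbb R^n)$ and its distribution kernel coincides on $\Gamma^c$ with a function $K:\Gamma^c\to\mathbb C$ for which there are $A,\delta>0$ such that, for all $(x,y)\notin\Gamma$, $$|K(x,y)|\le \frac{A}{\rho(x,y)^n},$$ $$|K(x,y)-K(x,y')|\le \frac{A|y-y'|^\delta}{\rho(x,y)^{n+\delta}}\quad\text{if } |y-y'|\le\tfrac12\rho(x,y),$$ $$|K(x,y)-K(x',y)|\le \frac{A|x-x'|^\delta}{\rho(x,y)^{n+\delta}}\quad\text{if } |x-x'|\le\tfrac12\rho(x,y),$$ and, for every $f\in C_c^\infty(\mathbb R^n)$, $Tf(x)=\int_{\mathbb R^n}K(x,y)f(y)\,dy$ for almost every $x\notin\gamma^{-1}(\operatorname{supp} f)$. \textbf{Theorem.} Let $\Gamma$ be a standard hyper curve, $T\in CZO_\gamma$ and $1<p<\infty$. Then the bounded extension of $T$ to $L^2(\mathbb R^n)$ extends further, from $L^1\cap L^2$ to a linear operator from $L^1(\mathbb R^n)$ to the (almost everywhere classes of) measurable functions and from $L^p\cap L^2$ to a linear operator from $L^p(\mathbb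 R^n)$ to itself, the extension to $L^1$ being independent of $p$, and with $T$ also denoting these extensions there is a constant $C>0$ such that $$\|Tf\|_{L^{1,\infty}}:=\sup_{t>0}t\,\bigl|\{x:|Tf(x)|>t\}\bigr|\le C\|f\|_{L^1}\quad\text{for all } f\in L^1(\mathbb R^n),$$ $$\|Tf\|_{L^p}\le C\|f\|_{L^p}\quad\text{for all } f\in L^p(\mathbb R^n).$$ -/

import Mathlib

open MeasureTheory
open scoped NNReal ENNReal Distributions

namespace CZGamma

/-- `ℝⁿ` with its Euclidean norm. -/
abbrev Rn (n : ℕ) : Type := EuclideanSpace ℝ (Fin n)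

/-- A closed domain: the closure of a domain, that is, of a nonempty connected open set. -/
def IsClosedDomain {n : ℕ} (D : Set (Rn n)) : Prop :=
  ∃ U : Set (Rn n), IsOpen U ∧ IsConnected U ∧ D = closure U

/-- A standard hyper curve in `ℝⁿ × ℝⁿ`: the union of the graphs of finitely many maps
`γ i : D i → ℝⁿ` on closed domains. The values of `γ i` outside `D i` play no role. -/
structure StandardHyperCurve (n : ℕ) where
  /-- the number of pieces -/
  r : ℕ
  r_pos : 0 < r
  /-- the closed domains on which the pieces are defined -/
  D : Fin r → Set (Rn n)
  isClosedDomain : ∀ i, IsClosedDomain (D i)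
  /-- the maps whose graphs are the pieces -/
  γ : Fin r → Rn n → Rn n
  differentiableAt : ∀ i, ∀ x ∈ interior (D i), DifferentiableAt ℝ (γ i) x
  jacobian_ne_zero : ∀ i, ∀ x ∈ interior (D i), (fderiv ℝ (γ i) x).det ≠ 0
  finite_coincidence : ∀ i j, i < j → {x | x ∈ D i ∧ x ∈ D j ∧ γ i x = γ j x}.Finite
  /-- each `γ i` is Lipschitz, and so is its inverse `γ i (D i) → D i` -/
  bilipschitz : ∃ c : ℝ, 1 < c ∧ ∀ i, ∀ x ∈ D i, ∀ x' ∈ D i,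
    ‖γ i x - γ i x'‖ ≤ c * ‖x - x'‖ ∧ ‖x - x'‖ ≤ c * ‖γ i x - γ i x'‖

namespace StandardHyperCurve

variable {n : ℕ} (Γ : StandardHyperCurve n)

/-- The graph of the `i`-th map over `D i`, in `ℝⁿ × ℝⁿ` with its Euclidean distance. -/
def piece (i : Fin Γ.r) : Set (WithLp 2 (Rn n × Rn n)) :=
  {z | ∃ x ∈ Γ.D i, z = WithLp.toLp 2 (x, Γ.γ i x)}

/-- The union of the graphs. -/
def carrier : Set (WithLp 2 (Rn n × Rn n)) := ⋃ i, Γ.piece i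

/-- `x ∈ γ⁻¹(E)`: some `γ i` is defined at `x` with value in `E`. -/
def preimage (E : Set (Rn n)) : Set (Rn n) := ⋃ i, {x | x ∈ Γ.D i ∧ Γ.γ i x ∈ E}

/-- `ρ(x, y)`: the minimum of the Euclidean distances from `(x, y)` to the pieces. -/
noncomputable def rho (x y : Rn n) : ℝ :=
  ⨅ i, Metric.infDist (WithLp.toLp 2 (x, y)) (Γ.piece i)

end StandardHyperCurve

/-- The size and regularity conditions on a kernel defined off `Γ`
(the values of `K` on `Γ` play no role). -/
def IsStandardKernel {n : ℕ} (Γ : StandardHyperCurve n) (K : Rn n → Rn n → ℂ) : Prop :=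
  ∃ A δ : ℝ, 0 < A ∧ 0 < δ ∧
    (∀ x y, WithLp.toLp 2 (x, y) ∉ Γ.carrier → ‖K x y‖ ≤ A / Γ.rho x y ^ n) ∧
    (∀ x y y', WithLp.toLp 2 (x, y) ∉ Γ.carrier → ‖y - y'‖ ≤ 1 / 2 * Γ.rho x y →
      ‖K x y - K x y'‖ ≤ A * ‖y - y'‖ ^ δ / Γ.rho x y ^ ((n : ℝ) + δ)) ∧
    (∀ x x' y, WithLp.toLp 2 (x, y) ∉ Γ.carrier → ‖x - x'‖ ≤ 1 / 2 * Γ.rho x y →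
      ‖K x y - K x' y‖ ≤ A * ‖x - x'‖ ^ δ / Γ.rho x y ^ ((n : ℝ) + δ))

/-- `C_c^∞(ℝⁿ)`, complex valued, with its usual topology. -/
abbrev TestFn (n : ℕ) : Type := 𝓓((⊤ : TopologicalSpace.Opens (Rn n)), ℂ)

/-- `𝒟'(ℝⁿ)`. (Mathlib tests complex distributions against real test functions, which is the
same as testing `ℂ`-linearly against complex ones.) -/
abbrev Distr (n : ℕ) : Type := 𝓓'((⊤ : TopologicalSpace.Opens (Rn n)), ℂ)

/-- The class in `L²` of a test function. -/
noncomputable def toL2 {n : ℕ} (φ : TestFn n) : Lp ℂ 2 (volume : Measure (Rn n)) :=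
  MemLp.toLp φ (φ.continuous.memLp_of_hasCompactSupport φ.hasCompactSupport)

/-- The bounded operator `T₂` on `L²` extends `T`: for every test function `φ` the distribution
`T φ` is the one given by the function `T₂ φ`. -/
def IsL2Extension {n : ℕ} (T : TestFn n →L[ℂ] Distr n)
    (T₂ : Lp ℂ 2 (volume : Measure (Rn n)) →L[ℂ] Lp ℂ 2 (volume : Measure (Rn n))) : Prop :=
  ∀ (φ : TestFn n) (ψ : 𝓓((⊤ : TopologicalSpace.Opens (Rn n)), ℝ)),
    T φ ψ = ∫ x, ψ x • T₂ (toL2 φ) x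

/-- The class `CZO_γ`: `T` extends to a bounded operator on `L²`, its distribution kernel
coincides off `Γ` with a function `K` satisfying the size and regularity conditions, and
`T φ (x) = ∫ K(x, y) φ(y) dy` for (almost every) `x ∉ γ⁻¹(supp φ)`. -/
def IsCZO {n : ℕ} (Γ : StandardHyperCurve n) (T : TestFn n →L[ℂ] Distr n) : Prop :=
  ∃ T₂ : Lp ℂ 2 (volume : Measure (Rn n)) →L[ℂ] Lp ℂ 2 (volume : Measure (Rn n)),
    IsL2Extension T T₂ ∧
    ∃ K : Rn n → Rn n → ℂ, IsStandardKernel Γ K ∧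
      (∀ (φ : TestFn n) (ψ : 𝓓((⊤ : TopologicalSpace.Opens (Rn n)), ℝ)),
        (∀ x ∈ tsupport ψ, ∀ y ∈ tsupport φ, WithLp.toLp 2 (x, y) ∉ Γ.carrier) →
        T φ ψ = ∫ x, ψ x • ∫ y, K x y * φ y) ∧
      (∀ φ : TestFn n, ∀ᵐ x : Rn n, x ∉ Γ.preimage (tsupport φ) →
        T₂ (toL2 φ) x = ∫ y, K x y * φ y)

/-- The `L^{1,∞}` quasi-norm `sup_{t > 0} t |{x : |f(x)| > t}|`. -/
noncomputable def weakL1Norm {n : ℕ} (f : Rn n →ₘ[volume] ℂ) : ℝ≥0∞ :=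
  ⨆ t : ℝ≥0, (t : ℝ≥0∞) * volume {x | t < ‖f x‖₊}

end CZGamma

namespace CZGamma

/-! This is the Calderón–Zygmund argument with the diagonal replaced by `Γ`. The curve enters
through two facts. The function ρ is 1-Lipschitz in each variable; and, the pieces being
bi-Lipschitz, the sections {x : ρ(x, y) < t} and {y : ρ(x, y) < t} are covered by `r` sets of
diameter O(t), so their volume is O(tⁿ) uniformly (`exists_volume_rho_left_lt_le`,
`exists_volume_rho_right_lt_le`). Hence ρ^{-(n+δ)} integrates over {ρ ≥ s} to O(s^{-δ}), just as |x
- y|^{-(n+δ)} does in the classical case.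

Together with the regularity of `K` this yields the Hörmander-type estimate `HasAtomicDecay`: if b
has mean zero and lives in the ball of radius s about y₀, then S b is integrable off {ρ(·, y₀) <
2s}, with norm O(‖b‖₁). The exceptional set need not lie near the ball; only its volume matters.
Regularity in the other variable gives the same for the adjoint, by duality.

A dyadic Calderón–Zygmund decomposition turns this decay and L² boundedness into weak type (1,1),
for the operator and its adjoint (`HasAtomicDecay.exists_hasWeakType`). Marcinkiewicz interpolation
with L² then covers 1 < p < 2, and duality covers p > 2 (`exists_hasStrongType`). The extension to
L^p is by density. On L¹ the target carries only a quasi-norm, so values are built as almost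
everywhere limits along fast approximations and are pinned down by a weak-type inequality
(`IsWeakValue`). -/

variable {n : ℕ}

/-! ### Volume of the sublevel sets of ρ -/

/-- If the sublevel sets of `ρ` have the volume growth of balls, then `ρ^{-(n+δ)}` is integrable
where `ρ` is bounded below. -/
lemma exists_lintegral_one_div_rpow_le (n : ℕ) (M : ℝ≥0) {δ : ℝ} (hδ : 0 < δ) :
    ∃ C : ℝ≥0, ∀ ρ : Rn n → ℝ, Measurable ρ →
      (∀ t, 0 < t → volume {x | ρ x < t} ≤ M * ENNReal.ofReal (t ^ n)) →
      ∀ s, 0 < s → ∫⁻ x in {x | s ≤ ρ x}, ENNReal.ofReal (1 / ρ x ^ ((n : ℝ) + δ)) ≤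
        C * ENNReal.ofReal (s ^ (-δ)) := by
  have hq0 : (0 : ℝ) < 2 ^ (-δ) := by positivity
  have hq1 : (2 : ℝ) ^ (-δ) < 1 := Real.rpow_lt_one_of_one_lt_of_neg (by norm_num) (by linarith)
  refine ⟨M * Real.toNNReal (2 ^ n * (1 - 2 ^ (-δ))⁻¹), fun ρ hρ hM s hs => ?_⟩
  -- Dyadic shells: the outer radius 2^{k+1}s gives the factor 2ⁿ of the constant, and summing the
  -- ratios 2^{-δ} gives (1 - 2^{-δ})⁻¹.
  let S : ℕ → Set (Rn n) := fun k => {x | 2 ^ k * s ≤ ρ x ∧ ρ x < 2 ^ (k + 1) * s}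
  have hcover : {x | s ≤ ρ x} ⊆ ⋃ k, S k := by
    intro x hx
    obtain ⟨k, hk1, hk2⟩ := exists_nat_pow_near (x := ρ x / s) (y := 2)
      ((one_le_div hs).2 hx) (by norm_num)
    exact Set.mem_iUnion.2 ⟨k, (le_div_iff₀ hs).1 hk1, (div_lt_iff₀ hs).1 hk2⟩
  have hS : ∀ k, MeasurableSet (S k) := fun k =>
    (measurableSet_le measurable_const hρ).inter (measurableSet_lt hρ measurable_const)
  have hterm : ∀ k, ∫⁻ x in S k, ENNReal.ofReal (1 / ρ x ^ ((n : ℝ) + δ)) ≤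
      M * ENNReal.ofReal (2 ^ n * s ^ (-δ) * (2 ^ (-δ)) ^ k) := by
    intro k
    have hk : (0 : ℝ) < 2 ^ k * s := by positivity
    calc ∫⁻ x in S k, ENNReal.ofReal (1 / ρ x ^ ((n : ℝ) + δ))
        ≤ ∫⁻ x in S k, ENNReal.ofReal (1 / (2 ^ k * s) ^ ((n : ℝ) + δ)) := by
          refine setLIntegral_mono' (hS k) fun x hx => ENNReal.ofReal_le_ofReal ?_
          exact one_div_le_one_div_of_le (by positivity)
            (Real.rpow_le_rpow hk.le hx.1 (by positivity))
      _ = ENNReal.ofReal (1 / (2 ^ k * s) ^ ((n : ℝ) + δ)) * volume (S k) := by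
          rw [setLIntegral_const]
      _ ≤ ENNReal.ofReal (1 / (2 ^ k * s) ^ ((n : ℝ) + δ)) *
          (M * ENNReal.ofReal ((2 ^ (k + 1) * s) ^ n)) := by
          gcongr
          exact (measure_mono fun x hx => hx.2).trans (hM _ (by positivity))
      _ = M * ENNReal.ofReal (2 ^ n * s ^ (-δ) * (2 ^ (-δ)) ^ k) := by
          rw [mul_left_comm, ← ENNReal.ofReal_mul (by positivity)]
          congr 2
          rw [Real.rpow_add hk, Real.rpow_natCast, ← Real.rpow_natCast (2 ^ (-δ)) k,
            ← Real.rpow_mul (by norm_num), Real.mul_rpow (by positivity) hs.le,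
            ← Real.rpow_natCast 2 k, ← Real.rpow_mul (by norm_num), neg_mul, mul_comm δ,
            Real.rpow_neg hs.le, Real.rpow_neg (by norm_num), pow_succ]
          have : ((2 : ℝ) ^ k * 2 * s) ^ n = (2 ^ (k : ℝ) * s) ^ n * 2 ^ n := by
            rw [Real.rpow_natCast, ← mul_pow]; ring
          rw [this]
          field_simp
  calc _ ≤ ∫⁻ x in ⋃ k, S k, ENNReal.ofReal (1 / ρ x ^ ((n : ℝ) + δ)) :=
        lintegral_mono_set hcover
    _ ≤ ∑' k, ∫⁻ x in S k, ENNReal.ofReal (1 / ρ x ^ ((n : ℝ) + δ)) := lintegral_iUnion_le _ _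
    _ ≤ ∑' k, M * ENNReal.ofReal (2 ^ n * s ^ (-δ) * (2 ^ (-δ)) ^ k) :=
        ENNReal.tsum_le_tsum hterm
    _ = _ := by
        rw [ENNReal.tsum_mul_left, ← ENNReal.ofReal_tsum_of_nonneg (fun k => by positivity)
          ((summable_geometric_of_lt_one hq0.le hq1).mul_left _), tsum_mul_left,
          tsum_geometric_of_lt_one hq0.le hq1, ENNReal.coe_mul, mul_assoc (M : ℝ≥0∞),
          ← ENNReal.ofReal.eq_1, ← ENNReal.ofReal_mul
            (mul_nonneg (by positivity) (inv_nonneg.2 (by linarith)))]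
        congr 2
        ring

/-- A union of `r` sets of diameter at most `R t` has volume at most a multiple of `tⁿ`. -/
lemma exists_volume_iUnion_le (n r : ℕ) {R : ℝ} (hR : 0 ≤ R) :
    ∃ M : ℝ≥0, ∀ (t : ℝ), 0 < t → ∀ S : Fin r → Set (Rn n),
      (∀ i, ∀ x ∈ S i, ∀ x' ∈ S i, ‖x - x'‖ ≤ R * t) →
      volume (⋃ i, S i) ≤ M * ENNReal.ofReal (t ^ n) := by
  have hB : volume (Metric.ball (0 : Rn n) 1) ≠ ∞ := measure_ball_lt_top.ne
  refine ⟨r * (Real.toNNReal (R ^ n) * (volume (Metric.ball (0 : Rn n) 1)).toNNReal),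
    fun t ht S hS => ?_⟩
  have h1 : ∀ i, volume (S i) ≤ ENNReal.ofReal (R ^ n) * volume (Metric.ball (0 : Rn n) 1) *
      ENNReal.ofReal (t ^ n) := by
    intro i
    rcases (S i).eq_empty_or_nonempty with h | ⟨x, hx⟩
    · simp [h]
    calc volume (S i) ≤ volume (Metric.closedBall x (R * t)) :=
          measure_mono fun z hz => by
            rw [Metric.mem_closedBall, dist_eq_norm]; exact hS i z hz x hx
      _ = _ := by
          rw [Measure.addHaar_closedBall _ _ (by positivity), finrank_euclideanSpace,
            Fintype.card_fin, mul_pow, ENNReal.ofReal_mul (by positivity)]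
          ring
  calc volume (⋃ i, S i) ≤ ∑ i, volume (S i) := measure_iUnion_fintype_le _ _
    _ ≤ ∑ _i : Fin r, ENNReal.ofReal (R ^ n) * volume (Metric.ball (0 : Rn n) 1) *
      ENNReal.ofReal (t ^ n) := Finset.sum_le_sum fun i _ => h1 i
    _ = _ := by
      rw [Finset.sum_const, Finset.card_univ, Fintype.card_fin, nsmul_eq_mul]
      simp only [ENNReal.coe_mul, ENNReal.coe_natCast, ENNReal.coe_toNNReal hB, ENNReal.ofReal]
      ring

namespace StandardHyperCurve

variable (Γ : StandardHyperCurve n)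

lemma nonempty_index : Nonempty (Fin Γ.r) := ⟨⟨0, Γ.r_pos⟩⟩

lemma piece_nonempty (i : Fin Γ.r) : (Γ.piece i).Nonempty := by
  obtain ⟨U, -, hU, h⟩ := Γ.isClosedDomain i
  obtain ⟨x, hx⟩ := hU.nonempty
  exact ⟨_, x, h ▸ subset_closure hx, rfl⟩

lemma rho_le (x y : Rn n) (i : Fin Γ.r) :
    Γ.rho x y ≤ Metric.infDist (WithLp.toLp 2 (x, y)) (Γ.piece i) :=
  ciInf_le ⟨0, by rintro _ ⟨i, rfl⟩; exact Metric.infDist_nonneg⟩ i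

lemma exists_infDist_lt {x y : Rn n} {t : ℝ} (h : Γ.rho x y < t) :
    ∃ i, Metric.infDist (WithLp.toLp 2 (x, y)) (Γ.piece i) < t := by
  have := Γ.nonempty_index
  exact exists_lt_of_ciInf_lt h

lemma rho_le_rho_add_dist (x y x' y' : Rn n) :
    Γ.rho x y ≤ Γ.rho x' y' + dist (WithLp.toLp 2 (x, y)) (WithLp.toLp 2 (x', y')) := by
  have := Γ.nonempty_index
  rw [← sub_le_iff_le_add]
  refine le_ciInf fun i => ?_
  rw [sub_le_iff_le_add]
  exact (Γ.rho_le x y i).trans Metric.infDist_le_infDist_add_dist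

lemma rho_le_rho_add_norm_right (x y y' : Rn n) : Γ.rho x y ≤ Γ.rho x y' + ‖y - y'‖ := by
  refine (Γ.rho_le_rho_add_dist x y x y').trans (le_of_eq ?_)
  rw [WithLp.prod_dist_eq_of_L2]
  simp [dist_eq_norm]

lemma rho_le_rho_add_norm_left (x x' y : Rn n) : Γ.rho x y ≤ Γ.rho x' y + ‖x - x'‖ := by
  refine (Γ.rho_le_rho_add_dist x y x' y).trans (le_of_eq ?_)
  rw [WithLp.prod_dist_eq_of_L2]
  simp [dist_eq_norm]

lemma continuous_rho_right (x : Rn n) : Continuous (Γ.rho x) :=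
  (LipschitzWith.of_le_add fun y y' => by
    simpa [dist_eq_norm] using Γ.rho_le_rho_add_norm_right x y y').continuous

lemma continuous_rho_left (y : Rn n) : Continuous fun x => Γ.rho x y :=
  (LipschitzWith.of_le_add fun x x' => by
    simpa [dist_eq_norm] using Γ.rho_le_rho_add_norm_left x x' y).continuous

lemma rho_nonpos_of_mem_piece {x y : Rn n} {i : Fin Γ.r}
    (h : WithLp.toLp 2 (x, y) ∈ Γ.piece i) : Γ.rho x y ≤ 0 :=
  (Γ.rho_le x y i).trans_eq (Metric.infDist_zero_of_mem h)

lemma notMem_carrier {x y : Rn n} (h : 0 < Γ.rho x y) :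
    WithLp.toLp 2 (x, y) ∉ Γ.carrier := fun h' => by
  obtain ⟨i, hi⟩ := Set.mem_iUnion.1 h'
  exact (Γ.rho_nonpos_of_mem_piece hi).not_gt h

lemma notMem_preimage {x : Rn n} {E : Set (Rn n)} (h : ∀ y ∈ E, 0 < Γ.rho x y) :
    x ∉ Γ.preimage E := fun h' => by
  obtain ⟨i, hi, hE⟩ := Set.mem_iUnion.1 h'
  exact (Γ.rho_nonpos_of_mem_piece (i := i) ⟨x, hi, rfl⟩).not_gt (h _ hE)

/-- A point near a graph is near a point of the graph in both coordinates. -/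
lemma exists_near_of_infDist_lt {x y : Rn n} {t : ℝ} {i : Fin Γ.r}
    (h : Metric.infDist (WithLp.toLp 2 (x, y)) (Γ.piece i) < t) :
    ∃ z ∈ Γ.D i, ‖x - z‖ < t ∧ ‖y - Γ.γ i z‖ < t := by
  obtain ⟨_, ⟨z, hz, rfl⟩, hd⟩ := (Metric.infDist_lt_iff (Γ.piece_nonempty i)).1 h
  rw [WithLp.prod_dist_eq_of_L2] at hd
  refine ⟨z, hz, lt_of_le_of_lt (Real.le_sqrt_of_sq_le ?_) hd,
    lt_of_le_of_lt (Real.le_sqrt_of_sq_le ?_) hd⟩ <;> simp [dist_eq_norm]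

/-- If x and x' are t-close to graph points over z and z' of the same piece, both within t of y in
the second coordinate, then γ z and γ z' are 2t-close. The Lipschitz bound on the inverse gives ‖z -
z'‖ ≤ 2ct, hence ‖x - x'‖ ≤ (2 + 2c)t. -/
lemma exists_volume_rho_left_lt_le : ∃ M : ℝ≥0, ∀ (y : Rn n) (t : ℝ), 0 < t →
    volume {x | Γ.rho x y < t} ≤ M * ENNReal.ofReal (t ^ n) := by
  obtain ⟨c, hc, hγ⟩ := Γ.bilipschitz
  obtain ⟨M, hM⟩ := exists_volume_iUnion_le n Γ.r (R := 2 + 2 * c) (by linarith)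
  refine ⟨M, fun y t ht => le_trans (measure_mono fun x hx => Set.mem_iUnion.2
    (Γ.exists_infDist_lt hx)) (hM t ht (fun i => {x | _}) fun i x hx x' hx' => ?_)⟩
  obtain ⟨z, hz, hxz, hyz⟩ := Γ.exists_near_of_infDist_lt hx
  obtain ⟨z', hz', hxz', hyz'⟩ := Γ.exists_near_of_infDist_lt hx'
  have h1 := (hγ i z hz z' hz').2
  have h2 : ‖Γ.γ i z - Γ.γ i z'‖ ≤ 2 * t := by
    have := norm_sub_le_norm_sub_add_norm_sub (Γ.γ i z) y (Γ.γ i z')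
    rw [norm_sub_rev (Γ.γ i z) y] at this
    linarith
  have h3 := norm_sub_le_norm_sub_add_norm_sub x z x'
  have h4 := norm_sub_le_norm_sub_add_norm_sub z z' x'
  rw [norm_sub_rev z' x'] at h4
  have h5 := mul_le_mul_of_nonneg_left h2 (by linarith : 0 ≤ c)
  linarith

/-- The mirror argument, with the Lipschitz bound on γ itself in place of that on its inverse. -/
lemma exists_volume_rho_right_lt_le : ∃ M : ℝ≥0, ∀ (x : Rn n) (t : ℝ), 0 < t →
    volume {y | Γ.rho x y < t} ≤ M * ENNReal.ofReal (t ^ n) := by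
  obtain ⟨c, hc, hγ⟩ := Γ.bilipschitz
  obtain ⟨M, hM⟩ := exists_volume_iUnion_le n Γ.r (R := 2 + 2 * c) (by linarith)
  refine ⟨M, fun x t ht => le_trans (measure_mono fun y hy => Set.mem_iUnion.2
    (Γ.exists_infDist_lt hy)) (hM t ht (fun i => {y | _}) fun i y hy y' hy' => ?_)⟩
  obtain ⟨z, hz, hxz, hyz⟩ := Γ.exists_near_of_infDist_lt hy
  obtain ⟨z', hz', hxz', hyz'⟩ := Γ.exists_near_of_infDist_lt hy'
  have h1 := (hγ i z hz z' hz').1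
  have h2 : ‖z - z'‖ ≤ 2 * t := by
    have := norm_sub_le_norm_sub_add_norm_sub z x z'
    rw [norm_sub_rev z x] at this
    linarith
  have h3 := norm_sub_le_norm_sub_add_norm_sub y (Γ.γ i z) y'
  have h4 := norm_sub_le_norm_sub_add_norm_sub (Γ.γ i z) (Γ.γ i z') y'
  rw [norm_sub_rev (Γ.γ i z') y'] at h4
  have h5 := mul_le_mul_of_nonneg_left h2 (by linarith : 0 ≤ c)
  linarith

end StandardHyperCurve
-- Test functions in L² and the kernel off `Γ`
/-- `L²(ℝⁿ)`. -/
abbrev L2 (n : ℕ) : Type := Lp ℂ 2 (volume : Measure (Rn n))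

/-- A smooth compactly supported function as a test function. -/
def mkTestFn {g : Rn n → ℂ} (hg : ContDiff ℝ (⊤ : ℕ∞) g) (hc : HasCompactSupport g) : TestFn n :=
  TestFunction.mk g hg hc (Set.subset_univ _)

lemma coeFn_toL2 (φ : TestFn n) : (toL2 φ : Rn n → ℂ) =ᵐ[volume] φ := MemLp.coeFn_toLp _

lemma dense_range_toL2 : DenseRange (toL2 : TestFn n → L2 n) := by
  refine (Lp.dense_hasCompactSupport_contDiff (F := ℂ) (μ := (volume : Measure (Rn n)))
    (p := 2) (by norm_num)).mono ?_
  rintro f ⟨g, hfg, hc, hg⟩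
  refine ⟨mkTestFn hg hc, ?_⟩
  ext1
  exact (coeFn_toL2 _).trans hfg.symm

/-- Test functions are dense in L², and a locally integrable function is determined by its
distribution. This transfers the kernel representation in `IsCZO` to any given L² extension. -/
lemma IsL2Extension.unique {T : TestFn n →L[ℂ] Distr n} {S S' : L2 n →L[ℂ] L2 n}
    (hS : IsL2Extension T S) (hS' : IsL2Extension T S') : S = S' := by
  refine ContinuousLinearMap.coeFn_injective
    (dense_range_toL2.equalizer S.continuous S'.continuous (funext fun φ => ?_))
  have hloc : ∀ f : L2 n, LocallyIntegrable f volume := fun f =>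
    (Lp.memLp f).locallyIntegrable (by norm_num)
  ext1
  refine ae_eq_of_integral_contDiff_smul_eq (hloc _) (hloc _) fun g hg hc => ?_
  exact (hS φ (TestFunction.mk g hg hc (Set.subset_univ _))).symm.trans
    (hS' φ (TestFunction.mk g hg hc (Set.subset_univ _)))

/-- The size and regularity conditions with given constants. -/
structure KernelBounds (Γ : StandardHyperCurve n) (K : Rn n → Rn n → ℂ) (A δ : ℝ) : Prop where
  A_pos : 0 < A
  δ_pos : 0 < δ
  size : ∀ x y, 0 < Γ.rho x y → ‖K x y‖ ≤ A / Γ.rho x y ^ n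
  reg_right : ∀ x y y', 0 < Γ.rho x y → ‖y - y'‖ ≤ 1 / 2 * Γ.rho x y →
    ‖K x y - K x y'‖ ≤ A * ‖y - y'‖ ^ δ / Γ.rho x y ^ ((n : ℝ) + δ)
  reg_left : ∀ x x' y, 0 < Γ.rho x y → ‖x - x'‖ ≤ 1 / 2 * Γ.rho x y →
    ‖K x y - K x' y‖ ≤ A * ‖x - x'‖ ^ δ / Γ.rho x y ^ ((n : ℝ) + δ)

/-- Points off `Γ` are described by ρ > 0. The implication used here, from ρ > 0 to being off `Γ`,
does not require the graphs to be closed. -/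
lemma IsStandardKernel.exists_kernelBounds {Γ : StandardHyperCurve n} {K : Rn n → Rn n → ℂ}
    (h : IsStandardKernel Γ K) : ∃ A δ, KernelBounds Γ K A δ := by
  obtain ⟨A, δ, hA, hδ, h1, h2, h3⟩ := h
  exact ⟨A, δ, hA, hδ, fun x y h => h1 x y (Γ.notMem_carrier h),
    fun x y y' h => h2 x y y' (Γ.notMem_carrier h), fun x x' y h => h3 x x' y (Γ.notMem_carrier h)⟩

namespace KernelBounds

variable {Γ : StandardHyperCurve n} {K : Rn n → Rn n → ℂ} {A δ : ℝ} (hK : KernelBounds Γ K A δ)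
include hK

/-- No measurability of `K` is assumed; it comes from this continuity where ρ > 0. -/
lemma continuousAt {x y : Rn n} (h : 0 < Γ.rho x y) : ContinuousAt (K x) y := by
  rw [ContinuousAt, tendsto_iff_norm_sub_tendsto_zero]
  have hlim : Filter.Tendsto (fun y' => A * ‖y - y'‖ ^ δ / Γ.rho x y ^ ((n : ℝ) + δ))
      (nhds y) (nhds 0) := by
    have : Continuous fun y' : Rn n => A * ‖y - y'‖ ^ δ / Γ.rho x y ^ ((n : ℝ) + δ) := by
      refine (continuous_const.mul ?_).div_const _
      exact (continuous_const.sub continuous_id).norm.rpow_const fun _ => Or.inr hK.δ_pos.le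
    have h' := this.tendsto y
    rwa [sub_self, norm_zero, Real.zero_rpow hK.δ_pos.ne', mul_zero, zero_div] at h'
  refine squeeze_zero' (Filter.Eventually.of_forall fun _ => norm_nonneg _) ?_ hlim
  filter_upwards [Metric.closedBall_mem_nhds y (half_pos h)] with y' hy'
  rw [norm_sub_rev]
  refine hK.reg_right x y y' h ?_
  rw [Metric.mem_closedBall, dist_eq_norm, norm_sub_rev] at hy'
  linarith

/-- By the size bound |K|² ≤ A²ρ^{-2n}, which is the tail integrand with δ = n. Square integrability
makes integration against `K x` an L²-continuous functional. -/
lemma memLp (x : Rn n) {s : ℝ} (hs : 0 < s) :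
    MemLp (K x) 2 (volume.restrict {y | s ≤ Γ.rho x y}) := by
  have hmeas : MeasurableSet {y | s ≤ Γ.rho x y} :=
    measurableSet_le measurable_const (Γ.continuous_rho_right x).measurable
  have hm : AEStronglyMeasurable (K x) (volume.restrict {y | s ≤ Γ.rho x y}) :=
    ContinuousOn.aestronglyMeasurable
      (fun y hy => (hK.continuousAt (hs.trans_le hy)).continuousWithinAt) hmeas
  refine ⟨hm, ?_⟩
  rw [eLpNorm_lt_top_iff_lintegral_rpow_enorm_lt_top (by norm_num) (by norm_num)]
  obtain ⟨M, hM⟩ := Γ.exists_volume_rho_right_lt_le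
  -- The choice δ = n below must be positive; for n = 0 the space is a point and the bound by a
  -- constant suffices.
  by_cases hn : n = 0
  · have : IsFiniteMeasure (volume : Measure (Rn n)) := by
      subst hn
      exact CompactSpace.isFiniteMeasure
    refine (setLIntegral_mono' hmeas (g := fun _ => ENNReal.ofReal (A ^ 2)) fun y hy => ?_).trans_lt
      ?_
    · have := hK.size x y (hs.trans_le hy)
      subst hn
      simp only [pow_zero, div_one] at this
      rw [← ofReal_norm, ENNReal.ofReal_rpow_of_nonneg (norm_nonneg _) (by norm_num)]
      refine ENNReal.ofReal_le_ofReal ?_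
      norm_num
      gcongr
    · rw [setLIntegral_const]
      exact ENNReal.mul_lt_top ENNReal.ofReal_lt_top (measure_lt_top _ _)
  obtain ⟨C, hC⟩ := exists_lintegral_one_div_rpow_le n M (δ := n)
    (by exact_mod_cast Nat.pos_of_ne_zero hn)
  refine (setLIntegral_mono' hmeas (g := fun y => ENNReal.ofReal (A ^ 2) *
    ENNReal.ofReal (1 / Γ.rho x y ^ ((n : ℝ) + n))) fun y hy => ?_).trans_lt ?_
  · have := hK.size x y (hs.trans_le hy)
    have hpos : 0 < Γ.rho x y := hs.trans_le hy
    rw [← ofReal_norm, ENNReal.ofReal_rpow_of_nonneg (norm_nonneg _) (by norm_num),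
      ← ENNReal.ofReal_mul (by positivity)]
    refine ENNReal.ofReal_le_ofReal ?_
    rw [Real.rpow_add hpos, Real.rpow_natCast]
    norm_num
    calc ‖K x y‖ ^ 2 ≤ (A / Γ.rho x y ^ n) ^ 2 := by gcongr
      _ = _ := by field_simp
  · rw [lintegral_const_mul' _ _ ENNReal.ofReal_ne_top]
    refine ENNReal.mul_lt_top ENNReal.ofReal_lt_top
      ((hC (Γ.rho x) (Γ.continuous_rho_right x).measurable (hM x) s hs).trans_lt ?_)
    exact ENNReal.mul_lt_top ENNReal.coe_lt_top ENNReal.ofReal_lt_top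

/-- Integration against `K(x, ·)` is bounded on the functions in `L²` that vanish where `(x, ·)` is
close to `Γ`. -/
lemma exists_inner_eq (x : Rn n) {s : ℝ} (hs : 0 < s) :
    ∃ κ : L2 n, ∀ f : L2 n, (∀ᵐ y, Γ.rho x y < s → f y = 0) →
      Integrable (fun y => K x y * f y) ∧ inner ℂ κ f = ∫ y, K x y * f y := by
  set S : Set (Rn n) := {y | s ≤ Γ.rho x y} with hS
  have hmeas : MeasurableSet S :=
    measurableSet_le measurable_const (Γ.continuous_rho_right x).measurable
  have hm : MemLp (S.indicator fun y => star (K x y)) 2 volume :=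
    (memLp_indicator_iff_restrict hmeas).2 (hK.memLp x hs).star
  set κ : L2 n := hm.toLp _
  refine ⟨κ, fun f hf => ?_⟩
  have hae : (fun y => inner ℂ (κ y) (f y)) =ᵐ[volume] fun y => K x y * f y := by
    filter_upwards [hm.coeFn_toLp, hf] with y h1 h2
    rw [h1, RCLike.inner_apply]
    by_cases hy : y ∈ S
    · rw [Set.indicator_of_mem hy]
      simp [mul_comm]
    · rw [h2 (lt_of_not_ge hy)]
      simp
  refine ⟨(L2.integrable_inner κ f).congr hae, ?_⟩
  rw [L2.inner_def]
  exact integral_congr_ae hae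

end KernelBounds

/-! ### The kernel representation on L² -/

/-- A smooth function that is `1` on the closed set `Y` and supported near `Y`. -/
lemma exists_smooth_cutoff {Y : Set (Rn n)} (hY : IsClosed Y) {ε : ℝ} (hε : 0 < ε) :
    ∃ χ : Rn n → ℝ, ContDiff ℝ (⊤ : ℕ∞) χ ∧ (∀ y, ‖χ y‖ ≤ 1) ∧ (∀ y ∈ Y, χ y = 1) ∧
      tsupport χ ⊆ Metric.thickening ε Y := by
  obtain ⟨f, hf0, hf1, hf⟩ := exists_contMDiffMap_zero_one_of_isClosed
    (modelWithCornersSelf ℝ (Rn n)) (n := (⊤ : ℕ∞))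
    (s := (Metric.thickening (ε / 2) Y)ᶜ) (t := Y) Metric.isOpen_thickening.isClosed_compl hY
    (Set.disjoint_left.2 fun y hy hy' => hy (Metric.self_subset_thickening (half_pos hε) Y hy'))
  refine ⟨f, f.contMDiff.contDiff, fun y => ?_, fun y hy => hf1 hy, ?_⟩
  · rw [Real.norm_of_nonneg (hf y).1]
    exact (hf y).2
  · refine (closure_mono (t := Metric.thickening (ε / 2) Y) fun y hy => ?_).trans
      ((Metric.closure_thickening_subset_cthickening _ _).trans
        (Metric.cthickening_subset_thickening' hε (half_lt_self hε) Y))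
    by_contra h
    exact hy (hf0 h)

/-- An element of `L²` that vanishes off a closed set is the limit of test functions supported
near that set. -/
lemma exists_seq_toL2_tendsto {Y : Set (Rn n)} (hY : IsClosed Y) {ε : ℝ} (hε : 0 < ε) {u : L2 n}
    (hu : ∀ᵐ y, y ∉ Y → u y = 0) :
    ∃ φ : ℕ → TestFn n, (∀ k, tsupport (φ k) ⊆ Metric.thickening ε Y) ∧
      Filter.Tendsto (fun k => toL2 (φ k)) Filter.atTop (nhds u) := by
  obtain ⟨χ, hχ, hχ1, hχY, hsupp⟩ := exists_smooth_cutoff hY hε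
  have hex : ∀ k : ℕ, ∃ φ : TestFn n, tsupport φ ⊆ Metric.thickening ε Y ∧
      ‖toL2 φ - u‖ ≤ 1 / ((k : ℝ) + 1) := by
    intro k
    obtain ⟨g, hgc, hg, hgu⟩ := (Lp.memLp u).exist_eLpNorm_sub_le (by norm_num) (by norm_num)
      (Nat.one_div_pos_of_nat (n := k) (α := ℝ))
    have hgc' : HasCompactSupport fun y => χ y • g y := hgc.smul_left (f := χ)
    have hg' : ContDiff ℝ (⊤ : ℕ∞) fun y => χ y • g y := hχ.smul hg
    obtain ⟨φ, hφ⟩ : ∃ φ : TestFn n, (φ : Rn n → ℂ) = fun y => χ y • g y :=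
      ⟨mkTestFn hg' hgc', rfl⟩
    refine ⟨φ, ?_, ?_⟩
    · rw [hφ]
      exact (closure_mono (Function.support_smul_subset_left _ _)).trans hsupp
    rw [Lp.norm_def]
    refine ENNReal.toReal_le_of_le_ofReal (by positivity) (le_trans ?_ hgu)
    refine eLpNorm_mono_ae ?_
    filter_upwards [Lp.coeFn_sub (toL2 φ) u, coeFn_toL2 φ, hu] with y h1 h2 h3
    rw [h1, Pi.sub_apply, Pi.sub_apply, h2, hφ, norm_sub_rev (u y)]
    -- Since χ = 1 on Y and u = 0 off Y, χu = u. Cutting off the approximant g therefore does not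
    -- increase its distance to u.
    have : χ y • g y - u y = χ y • (g y - u y) := by
      by_cases hy : y ∈ Y
      · rw [hχY y hy]; simp
      · rw [h3 hy]; simp
    rw [this, norm_smul]
    exact mul_le_of_le_one_left (norm_nonneg _) (hχ1 y)
  choose φ h1 h2 using hex
  refine ⟨φ, h1, ?_⟩
  rw [tendsto_iff_norm_sub_tendsto_zero]
  exact squeeze_zero (fun _ => norm_nonneg _) h2 tendsto_one_div_add_atTop_nhds_zero_nat

/-- The representation of `S u` by the kernel, away from the points related by `Γ` to the support of
`u`, extends from test functions to `L²`. -/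
lemma KernelBounds.ae_eq_integral {Γ : StandardHyperCurve n} {K : Rn n → Rn n → ℂ} {A δ : ℝ}
    (hK : KernelBounds Γ K A δ) {S : L2 n →L[ℂ] L2 n}
    (hS : ∀ φ : TestFn n, ∀ᵐ x : Rn n, x ∉ Γ.preimage (tsupport φ) →
        S (toL2 φ) x = ∫ y, K x y * φ y)
    {X Y : Set (Rn n)} (hY : IsClosed Y) {ε : ℝ} (hε : 0 < ε)
    (hXY : ∀ x ∈ X, ∀ y ∈ Y, ε ≤ Γ.rho x y) {u : L2 n} (hu : ∀ᵐ y, y ∉ Y → u y = 0) :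
    ∀ᵐ x, x ∈ X → S u x = ∫ y, K x y * u y := by
  obtain ⟨φ, hφ, hlim⟩ := exists_seq_toL2_tendsto hY (half_pos hε) hu
  -- The left side converges almost everywhere along a subsequence. The right side converges at each
  -- fixed x of `X`, by L² continuity of the kernel functional.
  obtain ⟨ns, hns, hae⟩ := (tendstoInMeasure_of_tendsto_Lp
    ((S.continuous.tendsto u).comp hlim)).exists_seq_tendsto_ae
  filter_upwards [hae, ae_all_iff.2 fun k => hS (φ k)] with x hx1 hx2 hxX
  -- The approximants leak out of Y by at most ε/2, and ρ is 1-Lipschitz, so they stay at ρ-distance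
  -- at least ε/2.
  have hnear : ∀ y ∈ Metric.thickening (ε / 2) Y, ε / 2 ≤ Γ.rho x y := by
    intro y hy
    obtain ⟨z, hz, hd⟩ := Metric.mem_thickening_iff.1 hy
    have h1 := hXY x hxX z hz
    have h2 := Γ.rho_le_rho_add_norm_right x z y
    rw [dist_eq_norm, norm_sub_rev] at hd
    linarith
  obtain ⟨κ, hκ⟩ := hK.exists_inner_eq x (half_pos hε)
  have hval : ∀ k, S (toL2 (φ k)) x = inner ℂ κ (toL2 (φ k)) := by
    intro k
    rw [hx2 k (Γ.notMem_preimage fun y hy => (half_pos hε).trans_le (hnear y (hφ k hy))),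
      (hκ (toL2 (φ k)) ?_).2]
    · refine integral_congr_ae ?_
      filter_upwards [coeFn_toL2 (φ k)] with y hy
      rw [hy]
    · filter_upwards [coeFn_toL2 (φ k)] with y hy hlt
      rw [hy]
      by_contra h
      exact (hnear y (hφ k (subset_tsupport _ h))).not_gt hlt
  have hlim2 : Filter.Tendsto (fun k => inner ℂ κ (toL2 (φ (ns k)))) Filter.atTop
      (nhds (inner ℂ κ u)) :=
    (tendsto_const_nhds.inner hlim).comp hns.tendsto_atTop
  rw [← (hκ u ?_).2]
  · refine tendsto_nhds_unique (hx1.congr fun k => ?_) hlim2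
    exact hval _
  · filter_upwards [hu] with y hy hlt
    refine hy fun hyY => ?_
    have := hXY x hxX y hyY
    linarith

/-! ### Decay on atoms, for the operator and its adjoint -/

/-- The operator maps a function of mean zero supported in a ball to a function that is integrable
off a set comparable in volume to the ball, with a uniform bound. -/
def HasAtomicDecay (S : L2 n →L[ℂ] L2 n) (M : ℝ≥0) : Prop :=
  ∀ (y₀ : Rn n) (s : ℝ), 0 < s → ∃ E : Set (Rn n), MeasurableSet E ∧
    volume E ≤ M * ENNReal.ofReal (s ^ n) ∧
    ∀ b : L2 n, (∀ᵐ y, y ∉ Metric.closedBall y₀ s → b y = 0) → ∫ y, b y = 0 →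
      ∫⁻ x in Eᶜ, ‖S b x‖ₑ ≤ M * ∫⁻ y, ‖b y‖ₑ

lemma integrable_of_ae_notMem_closedBall {b : L2 n} {y₀ : Rn n} {s : ℝ}
    (hb : ∀ᵐ y, y ∉ Metric.closedBall y₀ s → b y = 0) : Integrable b := by
  have h1 : IsFiniteMeasure (volume.restrict (Metric.closedBall y₀ s)) :=
    ⟨by rw [Measure.restrict_apply_univ]; exact measure_closedBall_lt_top⟩
  exact IntegrableOn.integrable_of_ae_notMem_eq_zero
    (((Lp.memLp b).restrict (Metric.closedBall y₀ s)).integrable (by norm_num)) hb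

/-- The bound on the kernel difference, integrated over the complement of the exceptional set. -/
lemma exists_lintegral_decay_le {A δ : ℝ} (hA : 0 < A) (hδ : 0 < δ) (M : ℝ≥0) :
    ∃ C : ℝ≥0, ∀ ρ : Rn n → ℝ, Measurable ρ →
      (∀ t, 0 < t → volume {x | ρ x < t} ≤ M * ENNReal.ofReal (t ^ n)) →
      ∀ s, 0 < s → ∫⁻ x in {x | 2 * s ≤ ρ x},
        ENNReal.ofReal (A * s ^ δ / ρ x ^ ((n : ℝ) + δ)) ≤ C := by
  obtain ⟨C, hC⟩ := exists_lintegral_one_div_rpow_le n M hδ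
  refine ⟨C * Real.toNNReal (A * 2 ^ (-δ)), fun ρ hρ hM s hs => ?_⟩
  have h1 : ∀ x, ENNReal.ofReal (A * s ^ δ / ρ x ^ ((n : ℝ) + δ)) =
      ENNReal.ofReal (A * s ^ δ) * ENNReal.ofReal (1 / ρ x ^ ((n : ℝ) + δ)) := fun x => by
    rw [← ENNReal.ofReal_mul (by positivity), mul_one_div]
  simp_rw [h1]
  rw [lintegral_const_mul' _ _ ENNReal.ofReal_ne_top]
  calc _ ≤ ENNReal.ofReal (A * s ^ δ) * (C * ENNReal.ofReal ((2 * s) ^ (-δ))) := by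
        gcongr
        exact hC ρ hρ hM _ (by positivity)
    _ = _ := by
        rw [mul_left_comm, ← ENNReal.ofReal_mul (by positivity), ENNReal.coe_mul,
          ← ENNReal.ofReal.eq_1]
        congr 2
        rw [Real.mul_rpow (by norm_num) hs.le, mul_left_comm, mul_assoc A,
          ← Real.rpow_add hs]
        simp [mul_comm]

namespace KernelBounds

variable {Γ : StandardHyperCurve n} {K : Rn n → Rn n → ℂ} {A δ : ℝ}

/-- The threshold 2s places ‖y - y₀‖ ≤ s within ρ/2, the range of the regularity condition. -/
lemma enorm_sub_right_le (hK : KernelBounds Γ K A δ) {x y y₀ : Rn n} {s : ℝ} (hs : 0 < s)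
    (hx : 2 * s ≤ Γ.rho x y₀) (hy : ‖y - y₀‖ ≤ s) :
    ‖K x y - K x y₀‖ₑ ≤ ENNReal.ofReal (A * s ^ δ / Γ.rho x y₀ ^ ((n : ℝ) + δ)) := by
  have hpos : 0 < Γ.rho x y₀ := by linarith
  have hA := hK.A_pos
  have hδ := hK.δ_pos
  rw [← ofReal_norm, norm_sub_rev]
  rw [norm_sub_rev] at hy
  refine ENNReal.ofReal_le_ofReal ((hK.reg_right x y₀ y hpos (by linarith)).trans ?_)
  gcongr

lemma enorm_sub_left_le (hK : KernelBounds Γ K A δ) {x x₀ y : Rn n} {s : ℝ} (hs : 0 < s)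
    (hy : 2 * s ≤ Γ.rho x₀ y) (hx : ‖x - x₀‖ ≤ s) :
    ‖K x y - K x₀ y‖ₑ ≤ ENNReal.ofReal (A * s ^ δ / Γ.rho x₀ y ^ ((n : ℝ) + δ)) := by
  have hpos : 0 < Γ.rho x₀ y := by linarith
  have hA := hK.A_pos
  have hδ := hK.δ_pos
  rw [← ofReal_norm, norm_sub_rev]
  rw [norm_sub_rev] at hx
  refine ENNReal.ofReal_le_ofReal ((hK.reg_left x₀ x y hpos (by linarith)).trans ?_)
  gcongr

variable {S : L2 n →L[ℂ] L2 n}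

/-- The set {ρ(·, y₀) < 2s} plays the role of the doubled ball. Off it the cancellation of b
replaces K(x, y) by K(x, y) - K(x, y₀), whose size is integrable in x uniformly in y. -/
lemma exists_hasAtomicDecay (hK : KernelBounds Γ K A δ)
    (hS : ∀ φ : TestFn n, ∀ᵐ x : Rn n, x ∉ Γ.preimage (tsupport φ) →
        S (toL2 φ) x = ∫ y, K x y * φ y) : ∃ M, HasAtomicDecay S M := by
  obtain ⟨M, hM⟩ := Γ.exists_volume_rho_left_lt_le
  obtain ⟨C, hC⟩ := exists_lintegral_decay_le (n := n) hK.A_pos hK.δ_pos M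
  refine ⟨max (M * Real.toNNReal (2 ^ n)) C, fun y₀ s hs => ?_⟩
  have hmeas : MeasurableSet {x | Γ.rho x y₀ < 2 * s} :=
    measurableSet_lt (Γ.continuous_rho_left y₀).measurable measurable_const
  refine ⟨_, hmeas, ?_, fun b hb hb0 => ?_⟩
  · refine (hM y₀ (2 * s) (by positivity)).trans ?_
    rw [mul_pow, ENNReal.ofReal_mul (by positivity), ← mul_assoc]
    gcongr
    rw [ENNReal.ofReal, ← ENNReal.coe_mul, ENNReal.coe_le_coe]
    exact le_max_left _ _
  have hXY : ∀ x ∈ {x | 2 * s ≤ Γ.rho x y₀}, ∀ y ∈ Metric.closedBall y₀ s, s ≤ Γ.rho x y := by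
    intro x hx y hy
    have h1 := Γ.rho_le_rho_add_norm_right x y₀ y
    rw [Metric.mem_closedBall, dist_eq_norm, norm_sub_rev] at hy
    linarith [hx.out]
  have hbi := integrable_of_ae_notMem_closedBall hb
  have hcompl : {x | Γ.rho x y₀ < 2 * s}ᶜ = {x | 2 * s ≤ Γ.rho x y₀} := by
    ext; simp
  rw [hcompl]
  have hptw : ∀ᵐ x, x ∈ {x | 2 * s ≤ Γ.rho x y₀} → ‖S b x‖ₑ ≤
      ENNReal.ofReal (A * s ^ δ / Γ.rho x y₀ ^ ((n : ℝ) + δ)) * ∫⁻ y, ‖b y‖ₑ := by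
    filter_upwards [hK.ae_eq_integral hS Metric.isClosed_closedBall hs hXY hb] with x hx hxX
    obtain ⟨κ, hκ⟩ := hK.exists_inner_eq x hs
    have hint := (hκ b (by
      filter_upwards [hb] with y hy hlt
      exact hy fun hyB => (hXY x hxX y hyB).not_gt hlt)).1
    rw [hx hxX]
    have : ∫ y, K x y * b y = ∫ y, (K x y - K x y₀) * b y := by
      simp_rw [sub_mul]
      rw [integral_sub hint (hbi.const_mul _), integral_const_mul, hb0, mul_zero, sub_zero]
    rw [this]
    refine (enorm_integral_le_lintegral_enorm _).trans ?_
    rw [← lintegral_const_mul' _ _ ENNReal.ofReal_ne_top]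
    refine lintegral_mono_ae ?_
    filter_upwards [hb] with y hy
    by_cases hyB : y ∈ Metric.closedBall y₀ s
    · rw [enorm_mul]
      gcongr
      rw [Metric.mem_closedBall, dist_eq_norm] at hyB
      exact hK.enorm_sub_right_le hs hxX hyB
    · simp [hy hyB]
  calc _ ≤ ∫⁻ x in {x | 2 * s ≤ Γ.rho x y₀},
        ENNReal.ofReal (A * s ^ δ / Γ.rho x y₀ ^ ((n : ℝ) + δ)) * ∫⁻ y, ‖b y‖ₑ :=
        setLIntegral_mono_ae' (hcompl ▸ hmeas.compl) hptw
    _ = (∫⁻ x in {x | 2 * s ≤ Γ.rho x y₀},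
        ENNReal.ofReal (A * s ^ δ / Γ.rho x y₀ ^ ((n : ℝ) + δ))) * ∫⁻ y, ‖b y‖ₑ :=
        lintegral_mul_const' _ _ hbi.hasFiniteIntegral.ne
    _ ≤ _ := by
        gcongr
        refine (hC _ (Γ.continuous_rho_left y₀).measurable (hM y₀) s hs).trans ?_
        exact_mod_cast le_max_right _ _

end KernelBounds

/-- The `L¹` norm of `h` on a set is at most the supremum of its pairings with bounded functions
supported there. -/
lemma setLIntegral_enorm_le_of_inner_le {h : L2 n} {E : Set (Rn n)} (hE : MeasurableSet E)
    {B : ℝ≥0∞} (hB : ∀ u : L2 n, (∀ᵐ y, ‖u y‖ ≤ 1) → (∀ᵐ y, y ∉ E → u y = 0) →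
      ‖inner ℂ h u‖ₑ ≤ B) : ∫⁻ y in E, ‖h y‖ₑ ≤ B := by
  -- Exhaustion by sets of finite measure, on which the phase of h belongs to L².
  have hmono : Monotone fun k : ℕ => E ∩ Metric.closedBall 0 (k : ℝ) := fun j k hjk =>
    Set.inter_subset_inter_right _ (Metric.closedBall_subset_closedBall (by exact_mod_cast hjk))
  have hun : E = ⋃ k : ℕ, E ∩ Metric.closedBall 0 (k : ℝ) := by
    rw [← Set.inter_iUnion, Metric.iUnion_closedBall_nat, Set.inter_univ]
  rw [hun, setLIntegral_iUnion_of_directed _ hmono.directed_le]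
  refine iSup_le fun k => ?_
  set F : Set (Rn n) := E ∩ Metric.closedBall 0 (k : ℝ)
  have hF : MeasurableSet F := hE.inter measurableSet_closedBall
  have hFtop : volume F ≠ ∞ :=
    ((measure_mono Set.inter_subset_right).trans_lt measure_closedBall_lt_top).ne
  -- The phase of h; where h vanishes the quotient 0/0 is 0, so the pairing is still |h|.
  set σ : Rn n → ℂ := F.indicator fun y => h y / (‖h y‖ : ℂ)
  have hσ1 : ∀ y, ‖σ y‖ ≤ 1 := fun y => by
    refine (norm_indicator_le_norm_self _ _).trans ?_
    rw [norm_div, Complex.norm_real, norm_norm]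
    exact div_self_le_one _
  have hσm : AEStronglyMeasurable σ := by
    have hm := (Lp.memLp h).aestronglyMeasurable
    exact (hm.aemeasurable.div
      (Complex.measurable_ofReal.comp_aemeasurable hm.norm.aemeasurable)).aestronglyMeasurable.indicator
        hF
  have hσ : MemLp σ 2 volume := by
    refine (memLp_indicator_const 2 hF (1 : ℂ) (Or.inr hFtop)).of_le hσm
      (Filter.Eventually.of_forall fun y => ?_)
    by_cases hy : y ∈ F
    · rw [Set.indicator_of_mem hy, norm_one]; exact hσ1 y
    · simp [σ, hy]
  set u : L2 n := hσ.toLp σ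
  have hu : u =ᵐ[volume] σ := hσ.coeFn_toLp
  have hint : ∀ᵐ y, inner ℂ (h y) (u y) = ((F.indicator (fun y => ‖h y‖) y : ℝ) : ℂ) := by
    filter_upwards [hu] with y hy
    rw [hy, RCLike.inner_apply]
    by_cases hyF : y ∈ F
    · simp only [σ, Set.indicator_of_mem hyF]
      by_cases h0 : h y = 0
      · simp [h0]
      · have h0' : (‖h y‖ : ℂ) ≠ 0 := by simpa using h0
        rw [div_mul_eq_mul_div, Complex.mul_conj, Complex.normSq_eq_norm_sq]
        push_cast
        field_simp
    · simp [σ, hyF]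
  have hval : inner ℂ h u = ((∫ y in F, ‖h y‖ : ℝ) : ℂ) := by
    rw [L2.inner_def, integral_congr_ae hint, integral_complex_ofReal, integral_indicator hF]
  have hhF : IntegrableOn (h : Rn n → ℂ) F := by
    have : IsFiniteMeasure (volume.restrict F) := ⟨by simpa using hFtop.lt_top⟩
    exact ((Lp.memLp h).restrict F).integrable (by norm_num)
  refine le_trans (le_of_eq ?_) (hB u ?_ ?_)
  · rw [hval, ← ofReal_norm, Complex.norm_real,
      Real.norm_of_nonneg (integral_nonneg fun _ => norm_nonneg _),
      ofReal_integral_norm_eq_lintegral_enorm hhF]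
  · filter_upwards [hu] with y hy
    rw [hy]; exact hσ1 y
  · filter_upwards [hu] with y hy hyE
    rw [hy]
    exact Set.indicator_of_notMem (fun h => hyE h.1) _

namespace KernelBounds

variable {Γ : StandardHyperCurve n} {K : Rn n → Rn n → ℂ} {A δ : ℝ} {S : L2 n →L[ℂ] L2 n}

/-- No kernel of the adjoint is needed. For |u| ≤ 1 supported where ρ(x₀, ·) ≥ 2s, the pairing of
S*b with u is that of b with S u, and regularity in the first variable shows that S u is within a
fixed constant of the number c on the ball carrying b. The mean zero of b removes c. -/
lemma exists_hasAtomicDecay_adjoint (hK : KernelBounds Γ K A δ)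
    (hS : ∀ φ : TestFn n, ∀ᵐ x : Rn n, x ∉ Γ.preimage (tsupport φ) →
        S (toL2 φ) x = ∫ y, K x y * φ y) :
    ∃ M, HasAtomicDecay (ContinuousLinearMap.adjoint S) M := by
  obtain ⟨M, hM⟩ := Γ.exists_volume_rho_right_lt_le
  obtain ⟨C, hC⟩ := exists_lintegral_decay_le (n := n) hK.A_pos hK.δ_pos M
  refine ⟨max (M * Real.toNNReal (2 ^ n)) C, fun x₀ s hs => ?_⟩
  have hmeas : MeasurableSet {y | Γ.rho x₀ y < 2 * s} :=
    measurableSet_lt (Γ.continuous_rho_right x₀).measurable measurable_const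
  refine ⟨_, hmeas, ?_, fun b hb hb0 => ?_⟩
  · refine (hM x₀ (2 * s) (by positivity)).trans ?_
    rw [mul_pow, ENNReal.ofReal_mul (by positivity), ← mul_assoc]
    gcongr
    rw [ENNReal.ofReal, ← ENNReal.coe_mul, ENNReal.coe_le_coe]
    exact le_max_left _ _
  have hcompl : {y | Γ.rho x₀ y < 2 * s}ᶜ = {y | 2 * s ≤ Γ.rho x₀ y} := by
    ext; simp
  rw [hcompl]
  set Y : Set (Rn n) := {y | 2 * s ≤ Γ.rho x₀ y} with hYdef
  have hY : IsClosed Y := isClosed_le continuous_const (Γ.continuous_rho_right x₀)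
  have hXY : ∀ x ∈ Metric.closedBall x₀ s, ∀ y ∈ Y, s ≤ Γ.rho x y := by
    intro x hx y hy
    have h1 := Γ.rho_le_rho_add_norm_left x₀ x y
    rw [Metric.mem_closedBall, dist_eq_norm, norm_sub_rev] at hx
    linarith [hy.out]
  have hbi := integrable_of_ae_notMem_closedBall hb
  refine setLIntegral_enorm_le_of_inner_le hY.measurableSet fun u hu1 huY => ?_
  rw [ContinuousLinearMap.adjoint_inner_left, L2.inner_def]
  have hx₀ : x₀ ∈ Metric.closedBall x₀ s := Metric.mem_closedBall_self hs.le
  have hvan : ∀ x ∈ Metric.closedBall x₀ s, ∀ᵐ y, Γ.rho x y < s → u y = 0 := by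
    intro x hx
    filter_upwards [huY] with y hy hlt
    exact hy fun hyY => (hXY x hx y hyY).not_gt hlt
  set c : ℂ := ∫ y, K x₀ y * u y
  have hptw : ∀ᵐ x, x ∈ Metric.closedBall x₀ s → ‖S u x - c‖ₑ ≤ C := by
    filter_upwards [hK.ae_eq_integral hS hY hs hXY huY] with x hx hxX
    obtain ⟨κ, hκ⟩ := hK.exists_inner_eq x hs
    obtain ⟨κ₀, hκ₀⟩ := hK.exists_inner_eq x₀ hs
    rw [hx hxX, ← integral_sub (hκ u (hvan x hxX)).1 (hκ₀ u (hvan x₀ hx₀)).1]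
    refine (enorm_integral_le_lintegral_enorm _).trans
      (le_trans ?_ (hC _ (Γ.continuous_rho_right x₀).measurable (hM x₀) s hs))
    rw [← lintegral_indicator hY.measurableSet]
    refine lintegral_mono_ae ?_
    filter_upwards [hu1, huY] with y h1 h2
    rw [← sub_mul]
    by_cases hy : y ∈ Y
    · rw [Set.indicator_of_mem hy, enorm_mul]
      rw [Metric.mem_closedBall, dist_eq_norm] at hxX
      refine (mul_le_of_le_one_right' ?_).trans (hK.enorm_sub_left_le hs hy hxX)
      rw [← ofReal_norm]
      exact ENNReal.ofReal_le_one.2 h1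
    · simp [h2 hy]
  have hbc : Integrable fun x => inner ℂ (b x) c := by
    simp_rw [RCLike.inner_apply]
    exact ((LinearIsometryEquiv.integrable_comp_iff (Complex.conjLIE)).2 hbi).const_mul c
  have hzero : ∫ x, inner ℂ (b x) c = 0 := by
    simp_rw [RCLike.inner_apply]
    rw [integral_const_mul, integral_conj, hb0, map_zero, mul_zero]
  have hsub : ∫ x, inner ℂ (b x) (S u x) = ∫ x, inner ℂ (b x) (S u x - c) := by
    simp_rw [inner_sub_right]
    rw [integral_sub (L2.integrable_inner b (S u)) hbc, hzero, sub_zero]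
  rw [hsub]
  refine (enorm_integral_le_lintegral_enorm _).trans ?_
  calc ∫⁻ x, ‖inner ℂ (b x) (S u x - c)‖ₑ ≤ ∫⁻ x, C * ‖b x‖ₑ := by
        refine lintegral_mono_ae ?_
        filter_upwards [hptw, hb] with x h1 h2
        by_cases hx : x ∈ Metric.closedBall x₀ s
        · rw [RCLike.inner_apply, enorm_mul, RCLike.enorm_conj]
          gcongr
          exact h1 hx
        · simp [h2 hx]
    _ = C * ∫⁻ x, ‖b x‖ₑ := lintegral_const_mul' _ _ ENNReal.coe_ne_top
    _ ≤ _ := by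
        gcongr
        exact_mod_cast le_max_right _ _

end KernelBounds
-- Dyadic cubes and the stopping time
/-- The half-open dyadic cube of side `2⁻ᵏ` and index `m`. -/
def dyadicCube (k : ℤ) (m : Fin n → ℤ) : Set (Rn n) := {x | ∀ i, ⌊(2 : ℝ) ^ k * x i⌋ = m i}

lemma measurableSet_dyadicCube (k : ℤ) (m : Fin n → ℤ) : MeasurableSet (dyadicCube k m) := by
  refine MeasurableSet.congr (s := ⋂ i, {x : Rn n | ⌊(2 : ℝ) ^ k * x i⌋ = m i})
    (MeasurableSet.iInter fun i => ?_) (by ext; simp [dyadicCube])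
  have h : Measurable fun x : Rn n => ⌊(2 : ℝ) ^ k * x i⌋ :=
    Int.measurable_floor.comp (measurable_const.mul (by fun_prop))
  exact h (measurableSet_singleton (m i))

lemma volume_dyadicCube (k : ℤ) (m : Fin n → ℤ) :
    volume (dyadicCube k m) = ENNReal.ofReal (((2 : ℝ) ^ (-k)) ^ n) := by
  have h2 : (0 : ℝ) < 2 ^ k := by positivity
  have h : dyadicCube k m = (MeasurableEquiv.toLp 2 (Fin n → ℝ)).symm ⁻¹'
      (Set.univ.pi fun i => Set.Ico (2 ^ (-k) * (m i : ℝ)) (2 ^ (-k) * (m i : ℝ) + 2 ^ (-k))) := by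
    ext x
    simp only [dyadicCube, Set.mem_ofPred_eq, Int.floor_eq_iff, Set.mem_preimage, Set.mem_pi,
      Set.mem_univ, true_implies, Set.mem_Ico]
    refine forall_congr' fun i => and_congr ?_ ?_
    · rw [zpow_neg, inv_mul_le_iff₀ h2]; rfl
    · rw [zpow_neg, ← mul_add_one, lt_inv_mul_iff₀ h2]; rfl
  rw [h, (EuclideanSpace.volume_preserving_symm_measurableEquiv_toLp (Fin n)).measure_preimage
    (MeasurableSet.univ_pi fun i => measurableSet_Ico).nullMeasurableSet, Real.volume_pi_Ico]
  simp only [add_sub_cancel_left, Finset.prod_const, Finset.card_univ, Fintype.card_fin]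
  rw [ENNReal.ofReal_pow (by positivity)]

lemma measureReal_dyadicCube (k : ℤ) (m : Fin n → ℤ) :
    volume.real (dyadicCube k m) = ((2 : ℝ) ^ (-k)) ^ n := by
  rw [Measure.real, volume_dyadicCube, ENNReal.toReal_ofReal (by positivity)]

lemma norm_sub_le_of_mem_dyadicCube {k : ℤ} {m : Fin n → ℤ} {x y : Rn n}
    (hx : x ∈ dyadicCube k m) (hy : y ∈ dyadicCube k m) : ‖x - y‖ ≤ √n * 2 ^ (-k) := by
  have h2 : (0 : ℝ) < 2 ^ k := by positivity
  rw [EuclideanSpace.norm_eq]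
  refine (Real.sqrt_le_sqrt (y := n * (2 ^ (-k)) ^ 2) ?_).trans_eq ?_
  · calc ∑ i, ‖(x - y) i‖ ^ 2 ≤ ∑ _i : Fin n, ((2 : ℝ) ^ (-k)) ^ 2 := by
          refine Finset.sum_le_sum fun i _ => ?_
          gcongr
          have h := Int.abs_sub_lt_one_of_floor_eq_floor ((hx i).trans (hy i).symm)
          rw [← mul_sub, abs_mul, abs_of_pos h2] at h
          rw [zpow_neg, ← one_div, le_div_iff₀' h2]
          exact h.le
      _ = _ := by simp
  · rw [Real.sqrt_mul (by positivity), Real.sqrt_sq (by positivity)]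

/-- The coarse index is the fine one divided by 2^{k-k'} with integer division, so a fine cube
determines the coarse cube containing it. -/
lemma dyadicCube_subset {k k' : ℤ} (hk : k' ≤ k) {m m' : Fin n → ℤ} {x : Rn n}
    (hx : x ∈ dyadicCube k m) (hx' : x ∈ dyadicCube k' m') :
    dyadicCube k m ⊆ dyadicCube k' m' := by
  intro y hy i
  rw [← hx' i]
  have hdiv : ∀ z : ℝ, ⌊(2 : ℝ) ^ k' * z⌋ = ⌊(2 : ℝ) ^ k * z⌋ / ((2 ^ (k - k').toNat : ℕ) : ℤ) := by
    intro z
    rw [← Int.floor_div_natCast]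
    congr 1
    have : ((2 ^ (k - k').toNat : ℕ) : ℝ) = 2 ^ (k - k') := by
      rw [Nat.cast_pow, Nat.cast_ofNat, ← zpow_natCast, Int.toNat_of_nonneg (by lia)]
    rw [this, zpow_sub₀ (by norm_num)]
    field_simp
  rw [hdiv, hdiv, hy i, hx i]

lemma exists_parent (k : ℤ) {m : Fin n → ℤ} (hne : (dyadicCube k m).Nonempty) :
    ∃ m', dyadicCube k m ⊆ dyadicCube (k - 1) m' := by
  obtain ⟨x, hx⟩ := hne
  exact ⟨fun i => ⌊(2 : ℝ) ^ (k - 1) * x i⌋, dyadicCube_subset (by lia) hx fun i => rfl⟩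

/-- The maximal dyadic cubes on which the average of `‖f‖` exceeds `t`. -/
def stoppingCubes (f : Rn n → ℂ) (t : ℝ) : Set (ℤ × (Fin n → ℤ)) :=
  {j | t * volume.real (dyadicCube j.1 j.2) < ∫ x in dyadicCube j.1 j.2, ‖f x‖ ∧
    ∀ k' < j.1, ∀ m', dyadicCube j.1 j.2 ⊆ dyadicCube k' m' →
      ∫ x in dyadicCube k' m', ‖f x‖ ≤ t * volume.real (dyadicCube k' m')}

section stoppingCubes

variable {f : Rn n → ℂ} {t : ℝ}

/-- Dyadic cubes that meet are nested. If the generations differ, the stopping condition of the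
finer cube forbids the coarser one from having average above t. -/
lemma pairwise_disjoint_stoppingCubes : Pairwise
    (Function.onFun Disjoint fun j : stoppingCubes f t => dyadicCube j.1.1 j.1.2) := by
  have key : ∀ j j' : stoppingCubes f t, ∀ x, x ∈ dyadicCube j.1.1 j.1.2 →
      x ∈ dyadicCube j'.1.1 j'.1.2 → j'.1.1 < j.1.1 → False := fun j j' x hx hx' hlt =>
    (j.2.2 _ hlt _ (dyadicCube_subset hlt.le hx hx')).not_gt j'.2.1
  intro j j' hne
  refine Set.disjoint_left.2 fun x hx hx' => ?_
  rcases lt_trichotomy j.1.1 j'.1.1 with h | h | h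
  · exact key j' j x hx' hx h
  · refine hne (Subtype.ext (Prod.ext h (funext fun i => ?_)))
    rw [← hx i, ← hx' i, h]
  · exact key j j' x hx hx' h

/-- The parent cube has average at most t, and its volume is 2ⁿ times as large. -/
lemma setIntegral_norm_le_of_mem_stoppingCubes (hf : Integrable f)
    {j : ℤ × (Fin n → ℤ)} (hj : j ∈ stoppingCubes f t) : ∫ x in dyadicCube j.1 j.2, ‖f x‖ ≤
      2 ^ n * t * volume.real (dyadicCube j.1 j.2) := by
  have hne : (dyadicCube j.1 j.2).Nonempty := by
    by_contra h
    have := hj.1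
    rw [Set.not_nonempty_iff_eq_empty.1 h] at this
    simp at this
  obtain ⟨m', hm'⟩ := exists_parent j.1 hne
  calc ∫ x in dyadicCube j.1 j.2, ‖f x‖ ≤ ∫ x in dyadicCube (j.1 - 1) m', ‖f x‖ :=
        setIntegral_mono_set hf.norm.integrableOn (ae_of_all _ fun _ => norm_nonneg _)
          hm'.eventuallyLE
    _ ≤ t * volume.real (dyadicCube (j.1 - 1) m') := hj.2 _ (by lia) _ hm'
    _ = _ := by
        rw [measureReal_dyadicCube, measureReal_dyadicCube, neg_sub, sub_eq_add_neg, zpow_add₀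
          (by norm_num), mul_pow]
        simp; ring

/-- Otherwise there is a coarsest cube through x with average above t, and it is a stopping cube. It
exists because such cubes have volume below ‖f‖₁/t, which bounds their generation from below; as
volumes are 2^{-kn}, this needs n > 0. -/
lemma setIntegral_norm_le_of_notMem_stoppingCubes (hn : 0 < n) (hf : Integrable f) (ht : 0 < t)
    {x : Rn n} (hx : x ∉ ⋃ j : stoppingCubes f t, dyadicCube j.1.1 j.1.2) (k : ℤ) :
    ∫ y in dyadicCube k (fun i => ⌊(2 : ℝ) ^ k * x i⌋), ‖f y‖ ≤
      t * volume.real (dyadicCube k fun i => ⌊(2 : ℝ) ^ k * x i⌋) := by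
  by_contra! hbad
  let P : ℤ → Prop := fun k => t * volume.real (dyadicCube k fun i => ⌊(2 : ℝ) ^ k * x i⌋) <
    ∫ y in dyadicCube k (fun i => ⌊(2 : ℝ) ^ k * x i⌋), ‖f y‖
  have hbdd : ∃ b : ℤ, ∀ z, P z → b ≤ z := by
    obtain ⟨N, hN⟩ := pow_unbounded_of_one_lt ((∫ y, ‖f y‖) / t) (one_lt_two (α := ℝ))
    refine ⟨-N, fun z hz => ?_⟩
    by_contra! hlt
    have h1 : (2 : ℝ) ^ N ≤ ((2 : ℝ) ^ (-z)) ^ n := by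
      calc (2 : ℝ) ^ N = 2 ^ (N : ℤ) := (zpow_natCast _ _).symm
        _ ≤ 2 ^ (-z) := zpow_le_zpow_right₀ (by norm_num) (by lia)
        _ ≤ _ := le_self_pow₀ (one_le_zpow₀ (by norm_num) (by lia)) hn.ne'
    have h2 : ∫ y in dyadicCube z (fun i => ⌊(2 : ℝ) ^ z * x i⌋), ‖f y‖ ≤ ∫ y, ‖f y‖ :=
      setIntegral_le_integral hf.norm (ae_of_all _ fun _ => norm_nonneg _)
    have h3 : t * volume.real (dyadicCube z fun i => ⌊(2 : ℝ) ^ z * x i⌋) < _ := hz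
    rw [measureReal_dyadicCube] at h3
    rw [div_lt_iff₀ ht] at hN
    nlinarith [mul_le_mul_of_nonneg_left h1 ht.le]
  obtain ⟨k₀, hk₀, hmin⟩ := Int.exists_least_of_bdd hbdd ⟨k, hbad⟩
  refine hx (Set.mem_iUnion.2 ⟨⟨(k₀, fun i => ⌊(2 : ℝ) ^ k₀ * x i⌋), hk₀, fun k' hk' m' hsub => ?_⟩,
    fun i => rfl⟩)
  -- A dyadic cube containing the cube of generation k₀ contains x, so it is the cube through x of
  -- its own generation.
  have hm' : m' = fun i => ⌊(2 : ℝ) ^ k' * x i⌋ :=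
    funext fun i => (hsub (show x ∈ dyadicCube k₀ _ from fun i => rfl) i).symm
  by_contra! hlt
  rw [hm'] at hlt
  exact (hmin k' hlt).not_gt hk'

/-- Lebesgue differentiation on balls: the cube of side ℓ through x lies in the ball of radius √n ℓ,
whose volume is a fixed multiple of ℓⁿ. The averages of |f - f(x)| over the cubes then tend to 0
while those of |f| are at most t. -/
lemma ae_norm_le_of_notMem_stoppingCubes (hn : 0 < n) (hf : Integrable f) (ht : 0 < t) :
    ∀ᵐ x, x ∉ ⋃ j : stoppingCubes f t, dyadicCube j.1.1 j.1.2 → ‖f x‖ ≤ t := by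
  filter_upwards [IsUnifLocDoublingMeasure.ae_tendsto_average_norm_sub (volume : Measure (Rn n))
    hf.locallyIntegrable 1] with x hx hxQ
  have hsq : (0 : ℝ) < √n := Real.sqrt_pos.2 (by exact_mod_cast hn)
  have hR : Filter.Tendsto (fun k : ℕ => √n * (2 : ℝ) ^ (-(k : ℤ))) Filter.atTop
      (nhdsWithin 0 (Set.Ioi 0)) := by
    refine tendsto_nhdsWithin_iff.2 ⟨?_, Filter.Eventually.of_forall fun k => by
      simp only [Set.mem_Ioi]; positivity⟩
    have h := (tendsto_pow_atTop_nhds_zero_of_lt_one (r := (1 / 2 : ℝ)) (by norm_num)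
      (by norm_num)).const_mul √n
    rw [mul_zero] at h
    refine h.congr fun k => ?_
    rw [zpow_neg, zpow_natCast, one_div, inv_pow]
  have hlim := hx (fun _ => x) _ hR (Filter.Eventually.of_forall fun k => by
    simp only [one_mul, Metric.mem_closedBall, dist_self]; positivity)
  set ω : ℝ := volume.real (Metric.ball (0 : Rn n) 1)
  have hlim2 := (hlim.const_mul (√n ^ n * ω)).const_add t
  rw [mul_zero, add_zero] at hlim2
  refine ge_of_tendsto hlim2 (Filter.Eventually.of_forall fun k => ?_)
  set ℓ : ℝ := (2 : ℝ) ^ (-(k : ℤ)) with hℓ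
  have hℓ0 : 0 < ℓ := by positivity
  set Q : Set (Rn n) := dyadicCube k fun i => ⌊(2 : ℝ) ^ (k : ℤ) * x i⌋
  have hxmem : x ∈ Q := fun i => rfl
  have hQv : volume.real Q = ℓ ^ n := measureReal_dyadicCube _ _
  have hQB : Q ⊆ Metric.closedBall x (√n * ℓ) := fun y hy => by
    rw [Metric.mem_closedBall, dist_eq_norm]
    exact norm_sub_le_of_mem_dyadicCube hy hxmem
  have hBv : volume.real (Metric.closedBall x (√n * ℓ)) = √n ^ n * ω * ℓ ^ n := by
    rw [Measure.real, Measure.addHaar_closedBall _ _ (by positivity), finrank_euclideanSpace,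
      Fintype.card_fin, ENNReal.toReal_mul, ENNReal.toReal_ofReal (by positivity), mul_pow]
    simp only [ω, Measure.real]; ring
  have hBtop : volume (Metric.closedBall x (√n * ℓ)) ≠ ∞ := measure_closedBall_lt_top.ne
  have hQtop : volume Q ≠ ∞ := ((measure_mono hQB).trans_lt hBtop.lt_top).ne
  have hintB : IntegrableOn (fun y => ‖f y - f x‖) (Metric.closedBall x (√n * ℓ)) :=
    (hf.integrableOn.sub (integrableOn_const hBtop)).norm
  have h1 : ∫ y in Q, ‖f y‖ ≤ t * ℓ ^ n := by
    rw [← hQv]; exact setIntegral_norm_le_of_notMem_stoppingCubes hn hf ht hxQ k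
  have h2 : ‖f x‖ * ℓ ^ n ≤ ∫ y in Q, (‖f y - f x‖ + ‖f y‖) := by
    rw [← hQv, mul_comm, ← smul_eq_mul, ← setIntegral_const]
    refine setIntegral_mono (integrableOn_const hQtop)
      ((hintB.mono_set hQB).add hf.norm.integrableOn) fun y => ?_
    have := norm_sub_norm_le (f x) (f y)
    beta_reduce
    rw [norm_sub_rev (f y)]
    linarith
  rw [integral_add (hintB.mono_set hQB) hf.norm.integrableOn] at h2
  have h3 : ∫ y in Q, ‖f y - f x‖ ≤ ∫ y in Metric.closedBall x (√n * ℓ), ‖f y - f x‖ :=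
    setIntegral_mono_set hintB (ae_of_all _ fun _ => norm_nonneg _) hQB.eventuallyLE
  rw [← measure_smul_setAverage _ hBtop, hBv, smul_eq_mul] at h3
  have hpos : 0 < ℓ ^ n := by positivity
  refine le_of_mul_le_mul_right (h2.trans ((add_le_add h3 h1).trans (le_of_eq ?_))) hpos
  ring

end stoppingCubes
-- The Calderón–Zygmund decomposition
/-- The good part of `f` at height `t`: its average on each stopping cube, and `f` elsewhere. -/
noncomputable def goodPart (f : Rn n → ℂ) (t : ℝ) (x : Rn n) : ℂ :=
  open Classical in
  if h : ∃ j : stoppingCubes f t, x ∈ dyadicCube j.1.1 j.1.2 then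
    ⨍ y in dyadicCube h.choose.1.1 h.choose.1.2, f y
  else f x

section goodPart

variable {f : Rn n → ℂ} {t : ℝ}

lemma goodPart_of_mem {j : stoppingCubes f t} {x : Rn n} (hx : x ∈ dyadicCube j.1.1 j.1.2) :
    goodPart f t x = ⨍ y in dyadicCube j.1.1 j.1.2, f y := by
  have h : ∃ j : stoppingCubes f t, x ∈ dyadicCube j.1.1 j.1.2 := ⟨j, hx⟩
  -- Disjointness of the stopping cubes makes the choice immaterial.
  have hj : h.choose = j := by
    by_contra hne
    exact Set.disjoint_left.1 (pairwise_disjoint_stoppingCubes hne) h.choose_spec hx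
  rw [goodPart, dif_pos h, hj]

lemma goodPart_of_notMem {x : Rn n}
    (hx : x ∉ ⋃ j : stoppingCubes f t, dyadicCube j.1.1 j.1.2) : goodPart f t x = f x :=
  dif_neg fun h => hx (Set.mem_iUnion.2 h)

lemma measurableSet_iUnion_stoppingCubes :
    MeasurableSet (⋃ j : stoppingCubes f t, dyadicCube j.1.1 j.1.2) :=
  MeasurableSet.iUnion fun _ => measurableSet_dyadicCube _ _

lemma volume_dyadicCube_ne_top (k : ℤ) (m : Fin n → ℤ) : volume (dyadicCube k m) ≠ ∞ := by
  rw [volume_dyadicCube]; exact ENNReal.ofReal_ne_top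

lemma volume_dyadicCube_ne_zero (k : ℤ) (m : Fin n → ℤ) : volume (dyadicCube k m) ≠ 0 := by
  rw [volume_dyadicCube]
  exact (ENNReal.ofReal_pos.2 (by positivity)).ne'

lemma aestronglyMeasurable_goodPart (hf : Integrable f) : AEStronglyMeasurable (goodPart f t) := by
  set Ω := ⋃ j : stoppingCubes f t, dyadicCube j.1.1 j.1.2
  have hΩ : MeasurableSet Ω := measurableSet_iUnion_stoppingCubes
  have h1 : AEStronglyMeasurable (goodPart f t) (volume.restrict Ω) := by
    refine (aestronglyMeasurable_iUnion_iff).2 fun j => ?_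
    refine (aestronglyMeasurable_const (b := ⨍ y in dyadicCube j.1.1 j.1.2, f y)).congr ?_
    filter_upwards [ae_restrict_mem (measurableSet_dyadicCube _ _)] with x hx
    rw [goodPart_of_mem hx]
  have h2 : AEStronglyMeasurable (goodPart f t) (volume.restrict Ωᶜ) := by
    refine hf.aestronglyMeasurable.restrict.congr ?_
    filter_upwards [ae_restrict_mem hΩ.compl] with x hx
    rw [goodPart_of_notMem hx]
  have := aestronglyMeasurable_union_iff.2 ⟨h1, h2⟩
  rwa [Set.union_compl_self, Measure.restrict_univ] at this

lemma norm_setAverage_le (s : Set (Rn n)) :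
    ‖⨍ y in s, f y‖ ≤ (volume.real s)⁻¹ * ∫ y in s, ‖f y‖ := by
  rw [setAverage_eq, norm_smul, Real.norm_of_nonneg (by positivity)]
  gcongr
  exact norm_integral_le_integral_norm _

lemma ae_norm_goodPart_le (hn : 0 < n) (hf : Integrable f) (ht : 0 < t) :
    ∀ᵐ x, ‖goodPart f t x‖ ≤ 2 ^ n * t := by
  filter_upwards [ae_norm_le_of_notMem_stoppingCubes hn hf ht] with x hx
  by_cases h : x ∈ ⋃ j : stoppingCubes f t, dyadicCube j.1.1 j.1.2
  · obtain ⟨j, hj⟩ := Set.mem_iUnion.1 h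
    rw [goodPart_of_mem hj]
    refine (norm_setAverage_le _).trans ?_
    have hpos : 0 < volume.real (dyadicCube j.1.1 j.1.2) :=
      ENNReal.toReal_pos (volume_dyadicCube_ne_zero _ _) (volume_dyadicCube_ne_top _ _)
    rw [inv_mul_le_iff₀ hpos, mul_comm]
    exact setIntegral_norm_le_of_mem_stoppingCubes hf j.2
  · rw [goodPart_of_notMem h]
    exact (hx h).trans (le_mul_of_one_le_left ht.le (one_le_pow₀ (by norm_num)))

lemma setLIntegral_enorm_goodPart_le (hf : Integrable f) (j : stoppingCubes f t) :
    ∫⁻ x in dyadicCube j.1.1 j.1.2, ‖goodPart f t x‖ₑ ≤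
      ∫⁻ x in dyadicCube j.1.1 j.1.2, ‖f x‖ₑ := by
  set Q := dyadicCube j.1.1 j.1.2
  have hpos : 0 < volume.real Q :=
    ENNReal.toReal_pos (volume_dyadicCube_ne_zero _ _) (volume_dyadicCube_ne_top _ _)
  rw [setLIntegral_congr_fun (g := fun _ => ‖⨍ y in Q, f y‖ₑ) (measurableSet_dyadicCube _ _)
    fun x hx => by rw [goodPart_of_mem hx], setLIntegral_const,
    ← ofReal_integral_norm_eq_lintegral_enorm hf.integrableOn, ← ofReal_norm,
    ← ofReal_measureReal (volume_dyadicCube_ne_top _ _), ← ENNReal.ofReal_mul (norm_nonneg _)]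
  refine ENNReal.ofReal_le_ofReal ?_
  rw [← le_div_iff₀ hpos, div_eq_inv_mul]
  exact norm_setAverage_le _

lemma tsum_setLIntegral_enorm_le :
    ∑' j : stoppingCubes f t, ∫⁻ x in dyadicCube j.1.1 j.1.2, ‖f x‖ₑ ≤ ∫⁻ x, ‖f x‖ₑ := by
  rw [← lintegral_iUnion (fun j => measurableSet_dyadicCube _ _) pairwise_disjoint_stoppingCubes]
  exact setLIntegral_le_lintegral _ _

lemma lintegral_enorm_goodPart_le (hf : Integrable f) :
    ∫⁻ x, ‖goodPart f t x‖ₑ ≤ ∫⁻ x, ‖f x‖ₑ := by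
  set Ω := ⋃ j : stoppingCubes f t, dyadicCube j.1.1 j.1.2 with hΩdef
  have hΩ : MeasurableSet Ω := measurableSet_iUnion_stoppingCubes
  rw [← lintegral_add_compl _ hΩ, ← lintegral_add_compl (fun x => ‖f x‖ₑ) hΩ]
  refine add_le_add ?_ (setLIntegral_congr_fun hΩ.compl fun x hx => ?_).le
  · rw [hΩdef, lintegral_iUnion (fun j => measurableSet_dyadicCube _ _)
      pairwise_disjoint_stoppingCubes, lintegral_iUnion (fun j => measurableSet_dyadicCube _ _)
      pairwise_disjoint_stoppingCubes]
    exact ENNReal.tsum_le_tsum fun j => setLIntegral_enorm_goodPart_le hf j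
  · rw [goodPart_of_notMem hx]

/-- The sup bound 2ⁿt times the L¹ bound. This is what lets the L² boundedness of the operator act
on data controlled in L¹. -/
lemma lintegral_enorm_sq_goodPart_le (hn : 0 < n) (hf : Integrable f) (ht : 0 < t) :
    ∫⁻ x, ‖goodPart f t x‖ₑ ^ 2 ≤ ENNReal.ofReal (2 ^ n * t) * ∫⁻ x, ‖f x‖ₑ := by
  calc ∫⁻ x, ‖goodPart f t x‖ₑ ^ 2 ≤ ∫⁻ x, ENNReal.ofReal (2 ^ n * t) * ‖goodPart f t x‖ₑ := by
        refine lintegral_mono_ae ?_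
        filter_upwards [ae_norm_goodPart_le hn hf ht] with x hx
        rw [sq]
        gcongr
        rw [← ofReal_norm]
        exact ENNReal.ofReal_le_ofReal hx
    _ ≤ _ := by
        rw [lintegral_const_mul' _ _ ENNReal.ofReal_ne_top]
        exact mul_le_mul_right (lintegral_enorm_goodPart_le hf) _

lemma tsum_volume_stoppingCubes_le (hf : Integrable f) (ht : 0 < t) :
    ENNReal.ofReal t * ∑' j : stoppingCubes f t, volume (dyadicCube j.1.1 j.1.2) ≤
      ∫⁻ x, ‖f x‖ₑ := by
  rw [← ENNReal.tsum_mul_left]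
  refine (ENNReal.tsum_le_tsum fun j => ?_).trans (tsum_setLIntegral_enorm_le (t := t))
  rw [← ofReal_integral_norm_eq_lintegral_enorm hf.integrableOn,
    ← ofReal_measureReal (volume_dyadicCube_ne_top _ _), ← ENNReal.ofReal_mul ht.le]
  exact ENNReal.ofReal_le_ofReal j.2.1.le

lemma setIntegral_sub_goodPart (hf : Integrable f) (j : stoppingCubes f t) :
    ∫ x in dyadicCube j.1.1 j.1.2, (f x - goodPart f t x) = 0 := by
  rw [setIntegral_congr_fun (g := fun x => f x - ⨍ y in dyadicCube j.1.1 j.1.2, f y)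
    (measurableSet_dyadicCube _ _) fun x hx => by simp only [goodPart_of_mem hx]]
  rw [integral_sub hf.integrableOn (integrableOn_const (volume_dyadicCube_ne_top _ _)),
    setIntegral_const, measure_smul_setAverage _ (volume_dyadicCube_ne_top _ _), sub_self]

end goodPart

/-! ### Weak type (1,1) -/

/-- An operator with atomic decay is bounded off the exceptional sets on a sum of atoms. -/
lemma HasAtomicDecay.exists_setLIntegral_le {S : L2 n →L[ℂ] L2 n} {M : ℝ≥0}
    (hS : HasAtomicDecay S M) {ι : Type*} [Countable ι] {Q : ι → Set (Rn n)}
    (hQ : ∀ j, MeasurableSet (Q j)) (hdisj : Pairwise (Function.onFun Disjoint Q))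
    {c : ι → Rn n} {s : ι → ℝ} (hs : ∀ j, 0 < s j) (hQc : ∀ j, Q j ⊆ Metric.closedBall (c j) (s j))
    {b : L2 n} (hb : ∀ᵐ x, x ∉ ⋃ j, Q j → b x = 0) (hb0 : ∀ j, ∫ x in Q j, b x = 0) :
    ∃ E : Set (Rn n), MeasurableSet E ∧
      volume E ≤ M * ∑' j, ENNReal.ofReal (s j ^ n) ∧
      ∫⁻ x in Eᶜ, ‖S b x‖ₑ ≤ M * ∫⁻ x, ‖b x‖ₑ := by
  choose E hE hEv hES using fun j => hS (c j) (s j) (hs j)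
  refine ⟨⋃ j, E j, MeasurableSet.iUnion hE, ?_, ?_⟩
  · refine (measure_iUnion_le _).trans ?_
    rw [← ENNReal.tsum_mul_left]
    exact ENNReal.tsum_le_tsum hEv
  set bj : ι → L2 n := fun j => ((Lp.memLp b).indicator (hQ j)).toLp _
  have hbj : ∀ j, bj j =ᵐ[volume] (Q j).indicator b := fun j => MemLp.coeFn_toLp _
  have hSbj : ∀ j, ∫⁻ x in (E j)ᶜ, ‖S (bj j) x‖ₑ ≤ M * ∫⁻ x in Q j, ‖b x‖ₑ := by
    intro j
    refine (hES j (bj j) ?_ ?_).trans_eq ?_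
    · filter_upwards [hbj j] with x hx hxn
      rw [hx, Set.indicator_of_notMem fun h => hxn (hQc j h)]
    · rw [integral_congr_ae (hbj j), integral_indicator (hQ j), hb0]
    · rw [← lintegral_indicator (hQ j)]
      congr 1
      refine lintegral_congr_ae ?_
      filter_upwards [hbj j] with x hx
      rw [hx, enorm_indicator_eq_indicator_enorm]
  refine setLIntegral_enorm_le_of_inner_le (MeasurableSet.iUnion hE).compl fun u hu1 hu0 => ?_
  -- The decomposition of b over the cubes is used only after pairing: moving S to u turns it into
  -- countable additivity of an integral, so no convergence of Σ S(bⱼ) in L² has to be shown.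
  have hsum : HasSum (fun j => inner ℂ (S (bj j)) u) (inner ℂ (S b) u) := by
    set v := ContinuousLinearMap.adjoint S u with hv
    have hint := L2.integrable_inner (𝕜 := ℂ) b v
    have h := hasSum_integral_iUnion (f := fun x : Rn n => inner ℂ (b x) (v x)) hQ hdisj
      hint.integrableOn
    have h1 : ∫ x in ⋃ j, Q j, inner ℂ (b x) (v x) = inner ℂ (S b) u := by
      rw [← ContinuousLinearMap.adjoint_inner_right, L2.inner_def,
        setIntegral_eq_integral_of_ae_compl_eq_zero]
      filter_upwards [hb] with x hx hxn
      rw [hx hxn, inner_zero_left]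
    have h2 : ∀ j, ∫ x in Q j, inner ℂ (b x) (v x) = inner ℂ (S (bj j)) u := by
      intro j
      rw [← ContinuousLinearMap.adjoint_inner_right, L2.inner_def, ← integral_indicator (hQ j)]
      refine integral_congr_ae ?_
      filter_upwards [hbj j] with x hx
      rw [hx]
      by_cases hxQ : x ∈ Q j <;> simp [hxQ, hv]
    simpa only [h1, h2] using h
  rw [← hsum.tsum_eq]
  refine enorm_tsum_le_tsum_enorm.trans ?_
  calc ∑' j, ‖inner ℂ (S (bj j)) u‖ₑ ≤ ∑' j, M * ∫⁻ x in Q j, ‖b x‖ₑ := by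
        refine ENNReal.tsum_le_tsum fun j => le_trans ?_ (hSbj j)
        rw [L2.inner_def]
        refine (enorm_integral_le_lintegral_enorm _).trans ?_
        rw [← lintegral_indicator (hE j).compl]
        refine lintegral_mono_ae ?_
        filter_upwards [hu1, hu0] with x h1 h0
        by_cases hx : x ∈ E j
        · have : u x = 0 := h0 fun h => h (Set.mem_iUnion.2 ⟨j, hx⟩)
          simp [this]
        · rw [Set.indicator_of_mem (Set.mem_compl hx), RCLike.inner_apply, enorm_mul,
            RCLike.enorm_conj]
          refine mul_le_of_le_one_left' ?_
          rw [← ofReal_norm]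
          exact ENNReal.ofReal_le_one.2 h1
    _ ≤ M * ∫⁻ x, ‖b x‖ₑ := by
        rw [ENNReal.tsum_mul_left, ← lintegral_iUnion hQ hdisj]
        gcongr
        exact Measure.restrict_le_self

lemma sq_mul_volume_lt_nnnorm_le (g : Rn n → ℂ) (hg : AEStronglyMeasurable g) (t : ℝ≥0) :
    (t : ℝ≥0∞) ^ 2 * volume {x | t < ‖g x‖₊} ≤ ∫⁻ x, ‖g x‖ₑ ^ 2 := by
  refine le_trans ?_ (mul_meas_ge_le_lintegral₀ (hg.enorm.pow_const 2) ((t : ℝ≥0∞) ^ 2))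
  gcongr with x
  exact fun h => pow_le_pow_left' (by exact_mod_cast le_of_lt h) 2

lemma lintegral_enorm_sq_eq (f : L2 n) : ∫⁻ x, ‖f x‖ₑ ^ 2 = ‖f‖ₑ ^ 2 := by
  rw [Lp.enorm_def, eLpNorm_eq_lintegral_rpow_enorm_toReal (by norm_num) (by norm_num),
    ← ENNReal.rpow_natCast, ← ENNReal.rpow_mul]
  norm_num

lemma lintegral_enorm_sq_apply_le (S : L2 n →L[ℂ] L2 n) (f : L2 n) :
    ∫⁻ x, ‖S f x‖ₑ ^ 2 ≤ (‖S‖₊ : ℝ≥0∞) ^ 2 * ∫⁻ x, ‖f x‖ₑ ^ 2 := by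
  rw [lintegral_enorm_sq_eq, lintegral_enorm_sq_eq, ← mul_pow]
  gcongr
  exact S.le_opENorm f

/-- The weak `(1, 1)` bound on `L¹ ∩ L²`. -/
def HasWeakType (S : L2 n →L[ℂ] L2 n) (C : ℝ≥0) : Prop :=
  ∀ f : L2 n, Integrable f → ∀ t : ℝ≥0, t * volume {x | t < ‖S f x‖₊} ≤ C * ∫⁻ x, ‖f x‖ₑ

/-- Split f = g + b at height t. Chebyshev in L² handles S g; for S b the exceptional sets have
total volume O(‖f‖₁/t), and Chebyshev in L¹ handles the rest. -/
theorem HasAtomicDecay.exists_hasWeakType {S : L2 n →L[ℂ] L2 n} {M : ℝ≥0}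
    (hS : HasAtomicDecay S M) (hn : 0 < n) : ∃ C, HasWeakType S C := by
  -- The summands come from S g at height t/2 with |g| ≤ 2ⁿt; from the exceptional sets, a cube of
  -- side ℓ lying in a ball of radius √n ℓ; and from S b at height t/2 with ‖b‖₁ ≤ 2‖f‖₁.
  refine ⟨4 * ‖S‖₊ ^ 2 * 2 ^ n + M * Real.toNNReal (√n ^ n) + 4 * M, fun f hf t => ?_⟩
  rcases eq_zero_or_pos t with rfl | ht
  · simp
  have ht' : (0 : ℝ) < t := ht
  set F : ℝ≥0∞ := ∫⁻ x, ‖f x‖ₑ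
  set Q : stoppingCubes f (t : ℝ) → Set (Rn n) := fun j => dyadicCube j.1.1 j.1.2 with hQdef
  have hQ : ∀ j, MeasurableSet (Q j) := fun j => measurableSet_dyadicCube _ _
  have hgsq := lintegral_enorm_sq_goodPart_le hn hf ht'
  have hgm := aestronglyMeasurable_goodPart (t := t) hf
  have hg2 : MemLp (goodPart f t) 2 := by
    refine ⟨hgm, ?_⟩
    rw [eLpNorm_lt_top_iff_lintegral_rpow_enorm_lt_top (by norm_num) (by norm_num)]
    simp only [ENNReal.toReal_ofNat, ENNReal.rpow_ofNat]
    exact hgsq.trans_lt (ENNReal.mul_lt_top ENNReal.ofReal_lt_top hf.hasFiniteIntegral)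
  set g : L2 n := hg2.toLp _
  have hg : g =ᵐ[volume] goodPart f t := hg2.coeFn_toLp
  set b : L2 n := f - g with hbdef
  have hb : b =ᵐ[volume] fun x => f x - goodPart f t x := by
    filter_upwards [Lp.coeFn_sub f g, hg] with x h1 h2
    rw [h1, Pi.sub_apply, h2]
  have hb1 : ∫⁻ x, ‖b x‖ₑ ≤ 2 * F := by
    calc ∫⁻ x, ‖b x‖ₑ ≤ ∫⁻ x, (‖f x‖ₑ + ‖goodPart f t x‖ₑ) := by
          refine lintegral_mono_ae ?_
          filter_upwards [hb] with x hx
          rw [hx]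
          exact enorm_sub_le
      _ = F + ∫⁻ x, ‖goodPart f t x‖ₑ := lintegral_add_left' hf.aestronglyMeasurable.enorm _
      _ ≤ F + F := add_le_add le_rfl (lintegral_enorm_goodPart_le hf)
      _ = 2 * F := (two_mul F).symm
  have hne : ∀ j, (Q j).Nonempty := fun j =>
    nonempty_of_measure_ne_zero (volume_dyadicCube_ne_zero j.1.1 j.1.2)
  have hsq : (0 : ℝ) < √n := Real.sqrt_pos.2 (by exact_mod_cast hn)
  obtain ⟨E, hE, hEv, hEb⟩ := hS.exists_setLIntegral_le hQ pairwise_disjoint_stoppingCubes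
    (c := fun j => (hne j).some) (s := fun j => √n * 2 ^ (-j.1.1)) (fun j => by positivity)
    (fun j x hx => by
      rw [Metric.mem_closedBall, dist_eq_norm]
      exact norm_sub_le_of_mem_dyadicCube hx (hne j).some_mem)
    (b := b) (by
      filter_upwards [hb] with x hx hxn
      rw [hx, goodPart_of_notMem hxn, sub_self])
    (fun j => by
      rw [integral_congr_ae (ae_restrict_of_ae hb)]
      exact setIntegral_sub_goodPart hf j)
  have hEv' : t * volume E ≤ M * Real.toNNReal (√n ^ n) * F := by
    calc t * volume E ≤ t * (M * ∑' j : stoppingCubes f (t : ℝ),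
          ENNReal.ofReal ((√n * 2 ^ (-j.1.1)) ^ n)) := by gcongr
      _ = M * Real.toNNReal (√n ^ n) * (ENNReal.ofReal t * ∑' j, volume (Q j)) := by
          simp_rw [hQdef, volume_dyadicCube, mul_pow]
          simp_rw [ENNReal.ofReal_mul (show 0 ≤ √n ^ n by positivity)]
          rw [ENNReal.tsum_mul_left, ENNReal.ofReal_coe_nnreal, ENNReal.ofReal]
          ring
      _ ≤ _ := by
          gcongr
          exact tsum_volume_stoppingCubes_le hf ht'
  have hgood : t * volume {x | t / 2 < ‖S g x‖₊} ≤ 4 * ‖S‖₊ ^ 2 * 2 ^ n * F := by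
    have h1 := sq_mul_volume_lt_nnnorm_le (S g) (Lp.memLp (S g)).aestronglyMeasurable (t / 2)
    have h2 := (h1.trans (lintegral_enorm_sq_apply_le S g)).trans (mul_le_mul_right
      ((lintegral_congr_ae (by filter_upwards [hg] with x hx; rw [hx])).trans_le hgsq) _)
    have ht0 : (t : ℝ≥0∞) ≠ 0 := by exact_mod_cast ht.ne'
    have h3 : (t : ℝ≥0∞) * (t * volume {x | t / 2 < ‖S g x‖₊}) ≤
        t * (4 * ‖S‖₊ ^ 2 * 2 ^ n * F) := by
      have hsplit : (t : ℝ≥0∞) = 2 * ((t / 2 : ℝ≥0) : ℝ≥0∞) := by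
        norm_cast
        rw [mul_div_cancel₀ t (by norm_num)]
      calc (t : ℝ≥0∞) * (t * volume {x | t / 2 < ‖S g x‖₊})
          = 4 * (((t / 2 : ℝ≥0) : ℝ≥0∞) ^ 2 * volume {x | t / 2 < ‖S g x‖₊}) := by
            rw [hsplit]
            ring
        _ ≤ 4 * ((‖S‖₊ : ℝ≥0∞) ^ 2 * (ENNReal.ofReal (2 ^ n * t) * F)) := by gcongr
        _ = _ := by
            rw [ENNReal.ofReal_mul (by positivity), ENNReal.ofReal_coe_nnreal,
              ENNReal.ofReal_pow (by norm_num), ENNReal.ofReal_ofNat]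
            ring
    exact (ENNReal.mul_le_mul_iff_right ht0 ENNReal.coe_ne_top).1 h3
  have hbad : t * volume ({x | t / 2 < ‖S b x‖₊} ∩ Eᶜ) ≤ 4 * M * F := by
    have h1 : ((t / 2 : ℝ≥0) : ℝ≥0∞) * volume ({x | t / 2 < ‖S b x‖₊} ∩ Eᶜ) ≤
        ∫⁻ x in Eᶜ, ‖S b x‖ₑ := by
      refine le_trans ?_ (mul_meas_ge_le_lintegral₀
        (Lp.memLp (S b)).aestronglyMeasurable.restrict.enorm ((t / 2 : ℝ≥0) : ℝ≥0∞))
      rw [Measure.restrict_apply' hE.compl]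
      gcongr with x
      exact fun h => by exact_mod_cast le_of_lt h
    calc (t : ℝ≥0∞) * volume ({x | t / 2 < ‖S b x‖₊} ∩ Eᶜ)
        = 2 * (((t / 2 : ℝ≥0) : ℝ≥0∞) * volume ({x | t / 2 < ‖S b x‖₊} ∩ Eᶜ)) := by
          rw [← mul_assoc]
          congr 1
          norm_cast
          rw [mul_div_cancel₀ t (by norm_num)]
      _ ≤ 2 * (M * (2 * F)) :=
          mul_le_mul_right (h1.trans (hEb.trans (mul_le_mul_right hb1 _))) _
      _ = _ := by ring
  have hcover : {x | t < ‖S f x‖₊} ≤ᵐ[volume] ({x | t / 2 < ‖S g x‖₊} ∪ E ∪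
      ({x | t / 2 < ‖S b x‖₊} ∩ Eᶜ) : Set (Rn n)) := by
    have hfgb : S f = S g + S b := by rw [← map_add, hbdef, add_sub_cancel]
    filter_upwards [Lp.coeFn_add (S g) (S b)] with x hx hxt
    by_contra hcon
    have hxE : x ∉ E := fun h => hcon (Or.inl (Or.inr h))
    have h1 : ‖S g x‖₊ ≤ t / 2 := not_lt.1 fun h => hcon (Or.inl (Or.inl h))
    have h2 : ‖S b x‖₊ ≤ t / 2 := not_lt.1 fun h => hcon (Or.inr ⟨h, hxE⟩)
    have h3 : t < ‖S f x‖₊ := hxt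
    rw [hfgb, hx, Pi.add_apply] at h3
    exact (h3.trans_le ((nnnorm_add_le _ _).trans (add_le_add h1 h2))).ne (add_halves t).symm
  calc t * volume {x | t < ‖S f x‖₊}
      ≤ t * (volume {x | t / 2 < ‖S g x‖₊} + volume E +
          volume ({x | t / 2 < ‖S b x‖₊} ∩ Eᶜ)) := by
        gcongr
        refine (measure_mono_ae hcover).trans ((measure_union_le _ _).trans ?_)
        gcongr
        exact measure_union_le _ _
    _ ≤ 4 * ‖S‖₊ ^ 2 * 2 ^ n * F + M * Real.toNNReal (√n ^ n) * F + 4 * M * F := by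
        rw [mul_add, mul_add]
        gcongr
    _ = _ := by
        push_cast
        ring

/-! ### Marcinkiewicz interpolation for 1 < p < 2 -/

lemma lintegral_Ioo_rpow {r a : ℝ} (hr : -1 < r) (ha : 0 ≤ a) :
    ∫⁻ t in Set.Ioo 0 a, ENNReal.ofReal (t ^ r) = ENNReal.ofReal (a ^ (r + 1) / (r + 1)) := by
  have hint : IntegrableOn (fun t : ℝ => t ^ r) (Set.Ioc 0 a) :=
    (intervalIntegrable_iff_integrableOn_Ioc_of_le ha).1
      (intervalIntegral.intervalIntegrable_rpow' hr)
  rw [restrict_Ioo_eq_restrict_Ioc, ← ofReal_integral_eq_lintegral_ofReal hint,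
    ← intervalIntegral.integral_of_le ha, integral_rpow (Or.inl hr),
    Real.zero_rpow (by linarith), sub_zero]
  filter_upwards [ae_restrict_mem measurableSet_Ioc] with t ht
  exact Real.rpow_nonneg ht.1.le _

lemma lintegral_Ioi_rpow {r a : ℝ} (hr : r < -1) (ha : 0 < a) :
    ∫⁻ t in Set.Ioi a, ENNReal.ofReal (t ^ r) = ENNReal.ofReal (-a ^ (r + 1) / (r + 1)) := by
  rw [← ofReal_integral_eq_lintegral_ofReal (integrableOn_Ioi_rpow_of_lt hr ha),
    integral_Ioi_rpow_of_lt hr ha]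
  filter_upwards [ae_restrict_mem measurableSet_Ioi] with t ht
  exact Real.rpow_nonneg (ha.trans ht).le _

section LayerCake

variable {α : Type*} [MeasurableSpace α] {μ : Measure α} [SFinite μ] {F : α → ℝ} {p : ℝ}

/-- Tonelli, with ∫₀^F t^{p-2} dt = F^{p-1}/(p-1); p > 1 gives convergence at 0. -/
lemma lintegral_upper_truncation (hF : Measurable F) (hF0 : ∀ x, 0 ≤ F x) (hp : 1 < p) :
    ∫⁻ t in Set.Ioi (0 : ℝ), (∫⁻ x in {x | t < F x}, ENNReal.ofReal (F x) ∂μ) *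
      ENNReal.ofReal (t ^ (p - 2)) =
    ENNReal.ofReal (1 / (p - 1)) * ∫⁻ x, ENNReal.ofReal (F x ^ p) ∂μ := by
  have h1 : ∀ t, (∫⁻ x in {x | t < F x}, ENNReal.ofReal (F x) ∂μ) * ENNReal.ofReal (t ^ (p - 2)) =
      ∫⁻ x, {z : ℝ × α | z.1 < F z.2}.indicator
        (fun z => ENNReal.ofReal (F z.2) * ENNReal.ofReal (z.1 ^ (p - 2))) (t, x) ∂μ := by
    intro t
    rw [← lintegral_mul_const' _ _ ENNReal.ofReal_ne_top,
      ← lintegral_indicator (measurableSet_lt measurable_const hF)]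
    rfl
  simp_rw [h1]
  rw [lintegral_lintegral_swap, ← lintegral_const_mul' _ _ ENNReal.ofReal_ne_top]
  · refine lintegral_congr fun x => ?_
    calc _ = ∫⁻ t in Set.Ioi (0 : ℝ), (Set.Iio (F x)).indicator
          (fun t => ENNReal.ofReal (F x) * ENNReal.ofReal (t ^ (p - 2))) t := rfl
      _ = ∫⁻ t in Set.Ioo 0 (F x), ENNReal.ofReal (F x) * ENNReal.ofReal (t ^ (p - 2)) := by
          rw [setLIntegral_indicator measurableSet_Iio, Set.inter_comm, Set.Ioi_inter_Iio]
      _ = _ := by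
          rw [lintegral_const_mul' _ _ ENNReal.ofReal_ne_top,
            lintegral_Ioo_rpow (by linarith) (hF0 x), ← ENNReal.ofReal_mul (hF0 x),
            ← ENNReal.ofReal_mul (one_div_nonneg.2 (by linarith))]
          congr 1
          rw [show p - 2 + 1 = p - 1 by ring, mul_div_assoc',
            ← Real.rpow_one_add' (hF0 x) (by linarith), one_div_mul_eq_div]
          ring_nf
  · refine Measurable.aemeasurable (Measurable.indicator ?_
      (measurableSet_lt measurable_fst (hF.comp measurable_snd)))
    exact ((hF.comp measurable_snd).ennreal_ofReal).mul
      ((measurable_fst.pow_const _).ennreal_ofReal)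

/-- Tonelli, with ∫_F^∞ t^{p-3} dt = F^{p-2}/(2-p) for F > 0; p < 2 gives convergence at infinity.
-/
lemma lintegral_lower_truncation_le (hF : Measurable F) (hF0 : ∀ x, 0 ≤ F x) (hp : p < 2) :
    ∫⁻ t in Set.Ioi (0 : ℝ), (∫⁻ x in {x | F x ≤ t}, ENNReal.ofReal (F x ^ 2) ∂μ) *
      ENNReal.ofReal (t ^ (p - 3)) ≤
    ENNReal.ofReal (1 / (2 - p)) * ∫⁻ x, ENNReal.ofReal (F x ^ p) ∂μ := by
  have h1 : ∀ t, (∫⁻ x in {x | F x ≤ t}, ENNReal.ofReal (F x ^ 2) ∂μ) *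
      ENNReal.ofReal (t ^ (p - 3)) =
      ∫⁻ x, {z : ℝ × α | F z.2 ≤ z.1}.indicator
        (fun z => ENNReal.ofReal (F z.2 ^ 2) * ENNReal.ofReal (z.1 ^ (p - 3))) (t, x) ∂μ := by
    intro t
    rw [← lintegral_mul_const' _ _ ENNReal.ofReal_ne_top,
      ← lintegral_indicator (measurableSet_le hF measurable_const)]
    rfl
  simp_rw [h1]
  rw [lintegral_lintegral_swap, ← lintegral_const_mul' _ _ ENNReal.ofReal_ne_top]
  · refine lintegral_mono fun x => ?_
    -- Where F vanishes the power integral diverges at 0, but the factor F² makes the integrand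
    -- zero.
    rcases (hF0 x).eq_or_lt with h0 | h0
    · refine le_of_eq_of_le ?_ zero_le
      refine (lintegral_congr fun t => ?_).trans lintegral_zero
      rw [Set.indicator_apply]
      split_ifs <;> simp [← h0]
    calc _ = ∫⁻ t in Set.Ioi (0 : ℝ), (Set.Ici (F x)).indicator
          (fun t => ENNReal.ofReal (F x ^ 2) * ENNReal.ofReal (t ^ (p - 3))) t := rfl
      _ = ∫⁻ t in Set.Ici (F x), ENNReal.ofReal (F x ^ 2) * ENNReal.ofReal (t ^ (p - 3)) := by
          rw [setLIntegral_indicator measurableSet_Ici, 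
            Set.inter_eq_left.2 (Set.Ici_subset_Ioi.2 h0)]
      _ = ENNReal.ofReal (1 / (2 - p)) * ENNReal.ofReal (F x ^ p) := by
          rw [lintegral_const_mul' _ _ ENNReal.ofReal_ne_top, ← restrict_Ioi_eq_restrict_Ici,
            lintegral_Ioi_rpow (by linarith) h0, ← ENNReal.ofReal_mul (by positivity),
            ← ENNReal.ofReal_mul (one_div_nonneg.2 (by linarith))]
          congr 1
          have h2 : F x ^ p = F x ^ 2 * F x ^ (p - 2) := by
            rw [← Real.rpow_two, ← Real.rpow_add h0]; ring_nf
          have h3 : 2 - p ≠ 0 := by linarith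
          have h4 : p - 2 ≠ 0 := by linarith
          rw [h2, show p - 3 + 1 = p - 2 by ring, show 2 - p = -(p - 2) by ring]
          field_simp
      _ ≤ _ := le_rfl
  · refine Measurable.aemeasurable (Measurable.indicator ?_
      (measurableSet_le (hF.comp measurable_snd) measurable_fst))
    exact (((hF.comp measurable_snd).pow_const 2).ennreal_ofReal).mul
      ((measurable_fst.pow_const _).ennreal_ofReal)

end LayerCake

/-- The distribution function of `S f` is controlled by the two truncations of `f`. -/
lemma HasWeakType.volume_lt_norm_le {S : L2 n →L[ℂ] L2 n} {C : ℝ≥0} (hS : HasWeakType S C)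
    (f : L2 n) {t : ℝ} (ht : 0 < t) : volume {x | t < ‖S f x‖} ≤
      2 * C * ((∫⁻ x in {x | t < ‖f x‖}, ENNReal.ofReal ‖f x‖) * ENNReal.ofReal (t ^ (-1 : ℝ))) +
      4 * ‖S‖₊ ^ 2 * ((∫⁻ x in {x | ‖f x‖ ≤ t}, ENNReal.ofReal (‖f x‖ ^ 2)) *
        ENNReal.ofReal (t ^ (-2 : ℝ))) := by
  have hfm : Measurable fun x => ‖f x‖ := (Lp.stronglyMeasurable f).norm.measurable
  set H : Set (Rn n) := {x | t < ‖f x‖} with hH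
  have hHm : MeasurableSet H := measurableSet_lt measurable_const hfm
  have hHc : Hᶜ = {x | ‖f x‖ ≤ t} := by ext; simp [hH]
  set fh : L2 n := ((Lp.memLp f).indicator hHm).toLp _
  have hfh : fh =ᵐ[volume] H.indicator f := MemLp.coeFn_toLp _
  set fl : L2 n := ((Lp.memLp f).indicator hHm.compl).toLp _
  have hfl : fl =ᵐ[volume] Hᶜ.indicator f := MemLp.coeFn_toLp _
  have hsum : f = fh + fl := by
    ext1
    filter_upwards [Lp.coeFn_add fh fl, hfh, hfl] with x h1 h2 h3
    rw [h1, Pi.add_apply, h2, h3, Set.indicator_self_add_compl_apply]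
  -- On {|f| > t} one has |f| ≤ |f|²/t, so the high part of an L² function is integrable and the
  -- weak bound applies to it.
  have hint : Integrable fh := by
    have h2 : Integrable fun x => ‖f x‖ ^ 2 := (Lp.memLp f).integrable_norm_pow (by norm_num)
    refine (h2.const_mul (1 / t)).mono' (Lp.memLp fh).aestronglyMeasurable ?_
    filter_upwards [hfh] with x hx
    rw [hx]
    by_cases hxH : x ∈ H
    · rw [Set.indicator_of_mem hxH, one_div, le_inv_mul_iff₀ ht, sq]
      gcongr
      exact hxH.out.le
    · rw [Set.indicator_of_notMem hxH, norm_zero]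
      positivity
  set τ : ℝ≥0 := (t / 2).toNNReal with hτ
  have hτpos : 0 < τ := Real.toNNReal_pos.2 (by positivity)
  have hτt : (τ : ℝ) = t / 2 := Real.coe_toNNReal _ (by positivity)
  have hcover : {x | t < ‖S f x‖} ≤ᵐ[volume]
      ({x | τ < ‖S fh x‖₊} ∪ {x | τ < ‖S fl x‖₊} : Set (Rn n)) := by
    have hfgb : S f = S fh + S fl := by rw [← map_add, ← hsum]
    filter_upwards [Lp.coeFn_add (S fh) (S fl)] with x hx hxt
    by_contra hcon
    have h1 : ‖S fh x‖ ≤ t / 2 := hτt ▸ NNReal.coe_le_coe.2 (not_lt.1 fun h => hcon (Or.inl h))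
    have h2 : ‖S fl x‖ ≤ t / 2 := hτt ▸ NNReal.coe_le_coe.2 (not_lt.1 fun h => hcon (Or.inr h))
    have h3 : t < ‖S f x‖ := hxt
    rw [hfgb, hx, Pi.add_apply] at h3
    linarith [norm_add_le (S fh x) (S fl x)]
  have hτ0 : (τ : ℝ≥0∞) ≠ 0 := by exact_mod_cast hτpos.ne'
  have hhi : volume {x | τ < ‖S fh x‖₊} ≤
      2 * C * ((∫⁻ x in H, ENNReal.ofReal ‖f x‖) * ENNReal.ofReal (t ^ (-1 : ℝ))) := by
    have h1 := hS fh hint τ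
    have h2 : ∫⁻ x, ‖fh x‖ₑ = ∫⁻ x in H, ENNReal.ofReal ‖f x‖ := by
      rw [← lintegral_indicator hHm]
      refine lintegral_congr_ae ?_
      filter_upwards [hfh] with x hx
      rw [hx, enorm_indicator_eq_indicator_enorm]
      simp only [ofReal_norm]
    rw [h2, mul_comm, ← ENNReal.le_div_iff_mul_le (Or.inl hτ0) (Or.inl ENNReal.coe_ne_top)] at h1
    refine h1.trans_eq ?_
    rw [div_eq_mul_inv, show ((τ : ℝ≥0∞))⁻¹ = 2 * ENNReal.ofReal (t ^ (-1 : ℝ)) by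
      rw [hτ, ← ENNReal.ofReal, ← ENNReal.ofReal_inv_of_pos (by positivity), inv_div,
        Real.rpow_neg_one, div_eq_mul_inv, ENNReal.ofReal_mul (by norm_num),
        ENNReal.ofReal_ofNat]]
    ring
  have hlo : volume {x | τ < ‖S fl x‖₊} ≤
      4 * ‖S‖₊ ^ 2 * ((∫⁻ x in {x | ‖f x‖ ≤ t}, ENNReal.ofReal (‖f x‖ ^ 2)) *
        ENNReal.ofReal (t ^ (-2 : ℝ))) := by
    have h1 := (sq_mul_volume_lt_nnnorm_le (S fl) (Lp.memLp (S fl)).aestronglyMeasurable τ).trans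
      (lintegral_enorm_sq_apply_le S fl)
    have h2 : ∫⁻ x, ‖fl x‖ₑ ^ 2 = ∫⁻ x in {x | ‖f x‖ ≤ t}, ENNReal.ofReal (‖f x‖ ^ 2) := by
      rw [← hHc, ← lintegral_indicator hHm.compl]
      refine lintegral_congr_ae ?_
      filter_upwards [hfl] with x hx
      rw [hx]
      by_cases hxH : x ∈ Hᶜ
      · rw [Set.indicator_of_mem hxH, Set.indicator_of_mem hxH, ENNReal.ofReal_pow (norm_nonneg _),
          ofReal_norm]
      · rw [Set.indicator_of_notMem hxH, Set.indicator_of_notMem hxH]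
        simp
    rw [h2, mul_comm, ← ENNReal.le_div_iff_mul_le (Or.inl (pow_ne_zero 2 hτ0))
      (Or.inl (ENNReal.pow_ne_top ENNReal.coe_ne_top))] at h1
    refine h1.trans_eq ?_
    rw [div_eq_mul_inv, show ((τ : ℝ≥0∞) ^ 2)⁻¹ = 4 * ENNReal.ofReal (t ^ (-2 : ℝ)) by
      rw [hτ, ← ENNReal.ofReal, ← ENNReal.ofReal_pow (by positivity),
        ← ENNReal.ofReal_inv_of_pos (by positivity), Real.rpow_neg ht.le, Real.rpow_two,
        show ((t / 2) ^ 2)⁻¹ = 4 * (t ^ 2)⁻¹ by field_simp; norm_num,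
        ENNReal.ofReal_mul (by norm_num), ENNReal.ofReal_ofNat]]
    ring
  exact (measure_mono_ae hcover).trans ((measure_union_le _ _).trans (add_le_add hhi hlo))

/-- Marcinkiewicz interpolation between weak `(1, 1)` and `L²`. -/
lemma HasWeakType.lintegral_rpow_le {S : L2 n →L[ℂ] L2 n} {C : ℝ≥0} (hS : HasWeakType S C)
    {p : ℝ} (hp1 : 1 < p) (hp2 : p < 2) (f : L2 n) :
    ∫⁻ x, ENNReal.ofReal (‖S f x‖ ^ p) ≤ ENNReal.ofReal p *
      (2 * C * ENNReal.ofReal (1 / (p - 1)) + 4 * ‖S‖₊ ^ 2 * ENNReal.ofReal (1 / (2 - p))) *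
      ∫⁻ x, ENNReal.ofReal (‖f x‖ ^ p) := by
  have hfm : Measurable fun x => ‖f x‖ := (Lp.stronglyMeasurable f).norm.measurable
  have hc1 : (2 * C : ℝ≥0∞) ≠ ∞ := by exact_mod_cast ENNReal.coe_ne_top (r := 2 * C)
  have hc2 : (4 * ‖S‖₊ ^ 2 : ℝ≥0∞) ≠ ∞ := by
    exact_mod_cast ENNReal.coe_ne_top (r := 4 * ‖S‖₊ ^ (2 : ℕ))
  rw [lintegral_rpow_eq_lintegral_meas_lt_mul volume (ae_of_all _ fun _ => norm_nonneg _)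
    (Lp.memLp (S f)).aestronglyMeasurable.norm.aemeasurable (by linarith), mul_assoc]
  gcongr
  -- The layer-cake weight t^{p-1} absorbs the factors t⁻¹ and t⁻² of the two truncation bounds.
  set Φ : ℝ → ℝ≥0∞ := fun t => (∫⁻ x in {x | t < ‖f x‖}, ENNReal.ofReal ‖f x‖) *
    ENNReal.ofReal (t ^ (p - 2))
  set Ψ : ℝ → ℝ≥0∞ := fun t => (∫⁻ x in {x | ‖f x‖ ≤ t}, ENNReal.ofReal (‖f x‖ ^ 2)) *
    ENNReal.ofReal (t ^ (p - 3))
  have hΦ : Measurable Φ := by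
    refine Measurable.mul ?_ ((measurable_id.pow_const _).ennreal_ofReal)
    refine Antitone.measurable fun s t hst => lintegral_mono_set fun x hx => ?_
    exact lt_of_le_of_lt hst hx
  calc ∫⁻ t in Set.Ioi (0 : ℝ), volume {x | t < ‖S f x‖} * ENNReal.ofReal (t ^ (p - 1))
      ≤ ∫⁻ t in Set.Ioi (0 : ℝ), (2 * C * Φ t + 4 * ‖S‖₊ ^ 2 * Ψ t) := by
        refine setLIntegral_mono' measurableSet_Ioi fun t ht => ?_
        have ht' : (0 : ℝ) < t := ht
        refine (mul_le_mul_left (hS.volume_lt_norm_le f ht') _).trans_eq ?_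
        have e1 : ENNReal.ofReal (t ^ (p - 2)) =
            ENNReal.ofReal (t ^ (-1 : ℝ)) * ENNReal.ofReal (t ^ (p - 1)) := by
          rw [← ENNReal.ofReal_mul (by positivity), ← Real.rpow_add ht']; ring_nf
        have e2 : ENNReal.ofReal (t ^ (p - 3)) =
            ENNReal.ofReal (t ^ (-2 : ℝ)) * ENNReal.ofReal (t ^ (p - 1)) := by
          rw [← ENNReal.ofReal_mul (by positivity), ← Real.rpow_add ht']; ring_nf
        simp only [Φ, Ψ, e1, e2]
        ring
    _ = 2 * C * (∫⁻ t in Set.Ioi (0 : ℝ), Φ t) +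
          4 * ‖S‖₊ ^ 2 * ∫⁻ t in Set.Ioi (0 : ℝ), Ψ t := by
        rw [lintegral_add_left (hΦ.const_mul _), lintegral_const_mul' _ _ hc1,
          lintegral_const_mul' _ _ hc2]
    _ ≤ 2 * C * (ENNReal.ofReal (1 / (p - 1)) * ∫⁻ x, ENNReal.ofReal (‖f x‖ ^ p)) +
          4 * ‖S‖₊ ^ 2 * (ENNReal.ofReal (1 / (2 - p)) * ∫⁻ x, ENNReal.ofReal (‖f x‖ ^ p)) := by
        gcongr
        · exact (lintegral_upper_truncation hfm (fun _ => norm_nonneg _) hp1).le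
        · exact lintegral_lower_truncation_le hfm (fun _ => norm_nonneg _) hp2
    _ = _ := by ring

/-- The strong `(p, p)` bound on `L^p ∩ L²`. -/
def HasStrongType (S : L2 n →L[ℂ] L2 n) (p : ℝ≥0∞) (C : ℝ≥0) : Prop :=
  ∀ f : L2 n, MemLp f p → eLpNorm (S f) p ≤ C * eLpNorm f p

lemma HasWeakType.exists_hasStrongType {S : L2 n →L[ℂ] L2 n} {C : ℝ≥0} (hS : HasWeakType S C)
    {p : ℝ≥0∞} (hp1 : 1 < p) (hp2 : p < 2) : ∃ C', HasStrongType S p C' := by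
  have hp0 : p ≠ 0 := (zero_lt_one.trans hp1).ne'
  have hptop : p ≠ ∞ := (hp2.trans ENNReal.ofNat_lt_top).ne
  have hr1 : 1 < p.toReal := by
    rwa [← ENNReal.toReal_one, ENNReal.toReal_lt_toReal ENNReal.one_ne_top hptop]
  have hr2 : p.toReal < 2 := by
    rwa [← ENNReal.toReal_ofNat, ENNReal.toReal_lt_toReal hptop ENNReal.ofNat_ne_top]
  set r := p.toReal
  set D : ℝ≥0∞ := ENNReal.ofReal r *
      (2 * C * ENNReal.ofReal (1 / (r - 1)) + 4 * ‖S‖₊ ^ 2 * ENNReal.ofReal (1 / (2 - r)))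
  have hD : D ≠ ∞ := by
    simp only [D, ENNReal.ofReal]
    exact_mod_cast ENNReal.coe_ne_top
  have hD' : D ^ (1 / r) ≠ ∞ := ENNReal.rpow_ne_top_of_nonneg (by positivity) hD
  refine ⟨(D ^ (1 / r)).toNNReal, fun f _ => ?_⟩
  have h := hS.lintegral_rpow_le hr1 hr2 f
  have e : ∀ z : ℂ, ENNReal.ofReal (‖z‖ ^ r) = ‖z‖ₑ ^ r := fun z => by
    rw [← ENNReal.ofReal_rpow_of_nonneg (norm_nonneg _) (by linarith), ofReal_norm]
  simp only [e] at h
  rw [ENNReal.coe_toNNReal hD', eLpNorm_eq_lintegral_rpow_enorm_toReal hp0 hptop,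
    eLpNorm_eq_lintegral_rpow_enorm_toReal hp0 hptop,
    ← ENNReal.mul_rpow_of_nonneg _ _ (by positivity)]
  gcongr

/-! ### Duality for p > 2 -/

lemma ennreal_rpow_le_of_le_mul_rpow {I D : ℝ≥0∞} {r s : ℝ} (hrs : r.HolderConjugate s)
    (hI : I ≠ ∞) (h : I ≤ D * I ^ (1 / s)) : I ^ (1 / r) ≤ D := by
  have hr := hrs.pos
  rcases eq_or_ne I 0 with rfl | hI0
  · rw [ENNReal.zero_rpow_of_pos (by positivity)]
    exact zero_le
  have hs0 : I ^ (1 / s) ≠ 0 := (ENNReal.rpow_pos (pos_iff_ne_zero.2 hI0) hI).ne'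
  have hst : I ^ (1 / s) ≠ ∞ :=
    ENNReal.rpow_ne_top_of_nonneg (one_div_nonneg.2 hrs.symm.nonneg) hI
  -- Cancelling I^{1/s} requires I < ∞; this is why S f is first restricted to a level set below.
  rw [← ENNReal.mul_le_mul_iff_left hs0 hst, ← ENNReal.rpow_add _ _ hI0 hI]
  rwa [one_div, one_div, hrs.inv_add_inv_eq_one, ENNReal.rpow_one, ← one_div]

/-- The bound on a level set of `h = S f`, by testing against `|h|^{p-2} h` there. -/
lemma setLIntegral_rpow_le_of_adjoint {S : L2 n →L[ℂ] L2 n} {r s : ℝ} {C : ℝ≥0} (hr : 2 < r)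
    (hrs : r.HolderConjugate s)
    (hS : HasStrongType (ContinuousLinearMap.adjoint S) (ENNReal.ofReal s) C)
    (f : L2 n) (N : ℝ) (hN : 0 ≤ N) :
    (∫⁻ x in {x | ‖S f x‖ ≤ N}, ‖S f x‖ₑ ^ r) ^ (1 / r) ≤
      C * (∫⁻ x, ‖f x‖ₑ ^ r) ^ (1 / r) := by
  have hr0 : 0 < r := by linarith
  have hs1 := hrs.symm.lt
  have hs0 : 0 < s := by linarith
  set h : L2 n := S f with hh
  have hhm : Measurable fun x => h x := (Lp.stronglyMeasurable h).measurable
  set A : Set (Rn n) := {x | ‖h x‖ ≤ N} with hA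
  have hAm : MeasurableSet A := measurableSet_le hhm.norm measurable_const
  -- The bound |h| ≤ N on A puts γ in L², since |γ| ≤ N^{r-2}|h|. Pairing γ with h gives |h|^r, and
  -- |γ|^s = |h|^r on A because (r-1)s = r.
  set γ : Rn n → ℂ := A.indicator fun x => ((‖h x‖ ^ (r - 2) : ℝ) : ℂ) * h x with hγ
  have hγm : AEStronglyMeasurable γ := by
    refine Measurable.aestronglyMeasurable (Measurable.indicator ?_ hAm)
    exact (Complex.measurable_ofReal.comp (hhm.norm.pow_const _)).mul hhm
  have hγnorm : ∀ x ∈ A, ‖γ x‖ = ‖h x‖ ^ (r - 1) := fun x hx => by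
    rw [hγ, Set.indicator_of_mem hx, norm_mul, Complex.norm_real,
      Real.norm_of_nonneg (by positivity), ← Real.rpow_add_one' (norm_nonneg _) (by linarith)]
    ring_nf
  have hγ2 : MemLp γ 2 := by
    refine ((Lp.memLp h).const_mul ((N ^ (r - 2) : ℝ) : ℂ)).of_le hγm (ae_of_all _ fun x => ?_)
    by_cases hx : x ∈ A
    · rw [hγ, Set.indicator_of_mem hx, norm_mul, norm_mul, Complex.norm_real, Complex.norm_real,
        Real.norm_of_nonneg (by positivity), Real.norm_of_nonneg (by positivity)]
      gcongr
      exact hx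
    · rw [hγ, Set.indicator_of_notMem hx, norm_zero]
      positivity
  set g : L2 n := hγ2.toLp γ
  have hg : g =ᵐ[volume] γ := hγ2.coeFn_toLp
  set I : ℝ≥0∞ := ∫⁻ x in A, ‖h x‖ₑ ^ r with hI
  have hIint : ∀ᵐ x, inner ℂ (g x) (h x) = ((A.indicator (fun x => ‖h x‖ ^ r) x : ℝ) : ℂ) := by
    filter_upwards [hg] with x hx
    rw [hx, RCLike.inner_apply]
    by_cases hxA : x ∈ A
    · rw [hγ, Set.indicator_of_mem hxA, Set.indicator_of_mem hxA, map_mul, Complex.conj_ofReal,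
        mul_left_comm, Complex.mul_conj, Complex.normSq_eq_norm_sq, ← Complex.ofReal_mul,
        ← Real.rpow_two, ← Real.rpow_add' (norm_nonneg _) (by linarith)]
      ring_nf
    · rw [hγ, Set.indicator_of_notMem hxA, Set.indicator_of_notMem hxA]
      simp
  have hnorm : ∀ x, ‖h x‖ₑ ^ r = ENNReal.ofReal (‖h x‖ ^ r) := fun x => by
    rw [← ENNReal.ofReal_rpow_of_nonneg (norm_nonneg _) hr0.le, ofReal_norm]
  have hIint2 : ∫⁻ x, ‖inner ℂ (g x) (h x)‖ₑ = I := by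
    rw [hI, ← lintegral_indicator hAm]
    refine lintegral_congr_ae ?_
    filter_upwards [hIint] with x hx
    rw [hx, ← ofReal_norm, Complex.norm_real, Real.norm_of_nonneg
      (Set.indicator_nonneg (fun _ _ => by positivity) x)]
    by_cases hxA : x ∈ A
    · rw [Set.indicator_of_mem hxA, Set.indicator_of_mem hxA, hnorm]
    · rw [Set.indicator_of_notMem hxA, Set.indicator_of_notMem hxA, ENNReal.ofReal_zero]
  have hgh : Integrable fun x => inner ℂ (g x) (h x) := L2.integrable_inner g h
  have hItop : I ≠ ∞ := hIint2 ▸ hgh.hasFiniteIntegral.ne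
  have hinner : ‖inner ℂ g h‖ₑ = I := by
    have h1 : inner ℂ g h = ((∫ x, ‖inner ℂ (g x) (h x)‖ : ℝ) : ℂ) := by
      rw [L2.inner_def, ← integral_complex_ofReal]
      refine integral_congr_ae ?_
      filter_upwards [hIint] with x hx
      rw [hx, Complex.norm_real, Real.norm_of_nonneg
        (Set.indicator_nonneg (fun _ _ => by positivity) x)]
    rw [h1, ← ofReal_norm, Complex.norm_real,
      Real.norm_of_nonneg (integral_nonneg fun _ => norm_nonneg _),
      ofReal_integral_norm_eq_lintegral_enorm hgh, hIint2]
  have hgs : ∫⁻ x, ‖g x‖ₑ ^ s = I := by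
    rw [hI, ← lintegral_indicator hAm]
    refine lintegral_congr_ae ?_
    filter_upwards [hg] with x hx
    rw [hx]
    by_cases hxA : x ∈ A
    · rw [Set.indicator_of_mem hxA, hnorm, ← ofReal_norm, hγnorm x hxA,
        ENNReal.ofReal_rpow_of_nonneg (by positivity) hs0.le, ← Real.rpow_mul (norm_nonneg _),
        hrs.sub_one_mul_conj]
    · rw [hγ, Set.indicator_of_notMem hxA, Set.indicator_of_notMem hxA, enorm_zero,
        ENNReal.zero_rpow_of_pos hs0]
  have hs0' : ENNReal.ofReal s ≠ 0 := (ENNReal.ofReal_pos.2 hs0).ne'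
  have heL : ∀ u : L2 n, eLpNorm u (ENNReal.ofReal s) = (∫⁻ x, ‖u x‖ₑ ^ s) ^ (1 / s) := fun u => by
    rw [eLpNorm_eq_lintegral_rpow_enorm_toReal hs0' ENNReal.ofReal_ne_top,
      ENNReal.toReal_ofReal hs0.le]
  have hgLs : MemLp g (ENNReal.ofReal s) := by
    refine ⟨(Lp.memLp g).aestronglyMeasurable, ?_⟩
    rw [heL, hgs]
    exact (ENNReal.rpow_ne_top_of_nonneg (by positivity) hItop).lt_top
  have hSg := hS g hgLs
  rw [heL, heL, hgs] at hSg
  refine ennreal_rpow_le_of_le_mul_rpow hrs hItop ?_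
  calc I = ‖inner ℂ (ContinuousLinearMap.adjoint S g) f‖ₑ := by
        rw [ContinuousLinearMap.adjoint_inner_left, ← hh, hinner]
    _ ≤ ∫⁻ x, ‖f x‖ₑ * ‖ContinuousLinearMap.adjoint S g x‖ₑ := by
        rw [L2.inner_def]
        refine (enorm_integral_le_lintegral_enorm _).trans_eq ?_
        simp_rw [RCLike.inner_apply, enorm_mul, RCLike.enorm_conj]
    _ ≤ (∫⁻ x, ‖f x‖ₑ ^ r) ^ (1 / r) *
          (∫⁻ x, ‖ContinuousLinearMap.adjoint S g x‖ₑ ^ s) ^ (1 / s) :=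
        ENNReal.lintegral_mul_le_Lp_mul_Lq volume hrs (Lp.memLp f).aestronglyMeasurable.enorm
          (Lp.memLp (ContinuousLinearMap.adjoint S g)).aestronglyMeasurable.enorm
    _ ≤ (∫⁻ x, ‖f x‖ₑ ^ r) ^ (1 / r) * (C * I ^ (1 / s)) := mul_le_mul_right hSg _
    _ = _ := by ring

/-- The bound on {|S f| ≤ N} does not depend on N, so monotone convergence over N gives the full
norm. -/
lemma HasStrongType.of_adjoint {S : L2 n →L[ℂ] L2 n} {r s : ℝ} {C : ℝ≥0} (hr : 2 < r)
    (hrs : r.HolderConjugate s)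
    (hS : HasStrongType (ContinuousLinearMap.adjoint S) (ENNReal.ofReal s) C) :
    HasStrongType S (ENNReal.ofReal r) C := by
  intro f _
  have hr0 : 0 < r := by linarith
  have hr0' : ENNReal.ofReal r ≠ 0 := (ENNReal.ofReal_pos.2 hr0).ne'
  rw [eLpNorm_eq_lintegral_rpow_enorm_toReal hr0' ENNReal.ofReal_ne_top,
    eLpNorm_eq_lintegral_rpow_enorm_toReal hr0' ENNReal.ofReal_ne_top, ENNReal.toReal_ofReal hr0.le]
  have hmono : Monotone fun k : ℕ => {x | ‖S f x‖ ≤ k} := fun j k hjk x hx =>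
    le_trans (b := (j : ℝ)) hx (by exact_mod_cast hjk)
  have hun : (⋃ k : ℕ, {x | ‖S f x‖ ≤ k}) = Set.univ :=
    Set.eq_univ_of_forall fun x => Set.mem_iUnion.2 (exists_nat_ge ‖S f x‖)
  rw [← setLIntegral_univ, ← hun, setLIntegral_iUnion_of_directed _ hmono.directed_le,
    one_div, ENNReal.rpow_inv_le_iff hr0]
  refine iSup_le fun k => ?_
  rw [← ENNReal.rpow_inv_le_iff hr0, ← one_div]
  exact setLIntegral_rpow_le_of_adjoint hr hrs hS f k (Nat.cast_nonneg k)

/-- Weak `(1, 1)` bounds on an operator and its adjoint give all strong bounds. -/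
theorem exists_hasStrongType {S : L2 n →L[ℂ] L2 n} {C C' : ℝ≥0} (hS : HasWeakType S C)
    (hS' : HasWeakType (ContinuousLinearMap.adjoint S) C') {p : ℝ≥0∞} (hp1 : 1 < p)
    (hptop : p < ∞) : ∃ D, HasStrongType S p D := by
  rcases lt_trichotomy p 2 with hp | rfl | hp
  · exact hS.exists_hasStrongType hp1 hp
  · refine ⟨‖S‖₊, fun f _ => ?_⟩
    have h := S.le_opENorm f
    rwa [Lp.enorm_def, Lp.enorm_def, enorm_eq_nnnorm] at h
  · have hr : 2 < p.toReal := by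
      rwa [← ENNReal.toReal_ofNat, ENNReal.toReal_lt_toReal ENNReal.ofNat_ne_top hptop.ne]
    have hrs := Real.HolderConjugate.conjExponent (p := p.toReal) (by linarith)
    set s := p.toReal.conjExponent
    have hs2 : s < 2 := by
      change p.toReal / (p.toReal - 1) < 2
      rw [div_lt_iff₀ (by linarith)]
      linarith
    obtain ⟨D, hD⟩ := hS'.exists_hasStrongType (p := ENNReal.ofReal s)
      (ENNReal.one_lt_ofReal.2 hrs.symm.lt)
      (by rw [← ENNReal.ofReal_ofNat 2]; exact (ENNReal.ofReal_lt_ofReal_iff (by norm_num)).2 hs2)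
    refine ⟨D, ?_⟩
    rw [← ENNReal.ofReal_toReal hptop.ne]
    exact hD.of_adjoint hr hrs

/-! ### The quasi-norm of L^{1,∞} -/

section weakL1Norm

lemma weakL1Norm_le_iff {f : Rn n →ₘ[volume] ℂ} {B : ℝ≥0∞} :
    weakL1Norm f ≤ B ↔ ∀ t : ℝ≥0, (t : ℝ≥0∞) * volume {x | t < ‖f x‖₊} ≤ B := iSup_le_iff

lemma mul_volume_le_weakL1Norm (f : Rn n →ₘ[volume] ℂ) (t : ℝ≥0) :
    (t : ℝ≥0∞) * volume {x | t < ‖f x‖₊} ≤ weakL1Norm f := weakL1Norm_le_iff.1 le_rfl t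

/-- If |f + g| > t then |f| or |g| exceeds t/2; halving the height costs the factor 2. -/
lemma weakL1Norm_add_le (f g : Rn n →ₘ[volume] ℂ) :
    weakL1Norm (f + g) ≤ 2 * (weakL1Norm f + weakL1Norm g) := by
  refine weakL1Norm_le_iff.2 fun t => ?_
  have hcover : {x | t < ‖(f + g) x‖₊} ≤ᵐ[volume]
      ({x | t / 2 < ‖f x‖₊} ∪ {x | t / 2 < ‖g x‖₊} : Set (Rn n)) := by
    filter_upwards [AEEqFun.coeFn_add f g] with x hx hxt
    by_contra hcon
    have h1 : ‖f x‖₊ ≤ t / 2 := not_lt.1 fun h => hcon (Or.inl h)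
    have h2 : ‖g x‖₊ ≤ t / 2 := not_lt.1 fun h => hcon (Or.inr h)
    have h3 : t < ‖(f + g) x‖₊ := hxt
    rw [hx, Pi.add_apply] at h3
    exact (h3.trans_le ((nnnorm_add_le _ _).trans (add_le_add h1 h2))).ne (add_halves t).symm
  have ht : (t : ℝ≥0∞) = 2 * ((t / 2 : ℝ≥0) : ℝ≥0∞) := by
    norm_cast
    rw [mul_div_cancel₀ t (by norm_num)]
  calc (t : ℝ≥0∞) * volume {x | t < ‖(f + g) x‖₊}
      ≤ t * (volume {x | t / 2 < ‖f x‖₊} + volume {x | t / 2 < ‖g x‖₊}) := by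
        gcongr
        exact (measure_mono_ae hcover).trans (measure_union_le _ _)
    _ = 2 * (((t / 2 : ℝ≥0) : ℝ≥0∞) * volume {x | t / 2 < ‖f x‖₊} +
          ((t / 2 : ℝ≥0) : ℝ≥0∞) * volume {x | t / 2 < ‖g x‖₊}) := by
        rw [ht]; ring
    _ ≤ _ := by
        gcongr <;> exact mul_volume_le_weakL1Norm _ _

lemma weakL1Norm_congr_nnnorm {f g : Rn n →ₘ[volume] ℂ}
    (h : ∀ᵐ x, ‖f x‖₊ = ‖g x‖₊) : weakL1Norm f = weakL1Norm g := by
  unfold weakL1Norm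
  congr! 3 with t
  refine measure_congr ?_
  filter_upwards [h] with x hx
  exact propext (by change t < ‖f x‖₊ ↔ t < ‖g x‖₊; rw [hx])

lemma weakL1Norm_neg (f : Rn n →ₘ[volume] ℂ) : weakL1Norm (-f) = weakL1Norm f :=
  weakL1Norm_congr_nnnorm (by
    filter_upwards [AEEqFun.coeFn_neg f] with x hx
    rw [hx, Pi.neg_apply, nnnorm_neg])

lemma weakL1Norm_sub_le (f g : Rn n →ₘ[volume] ℂ) :
    weakL1Norm (f - g) ≤ 2 * (weakL1Norm f + weakL1Norm g) := by
  rw [sub_eq_add_neg, ← weakL1Norm_neg g]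
  exact weakL1Norm_add_le f (-g)

lemma weakL1Norm_zero : weakL1Norm (0 : Rn n →ₘ[volume] ℂ) = 0 := by
  refine le_antisymm (weakL1Norm_le_iff.2 fun t => ?_) zero_le
  refine (mul_eq_zero_of_right _ (measure_mono_null_ae ?_ measure_empty)).le
  filter_upwards [AEEqFun.coeFn_zero (α := Rn n) (β := ℂ) (μ := volume)] with x hx hxt
  have h : t < ‖(0 : Rn n →ₘ[volume] ℂ) x‖₊ := hxt
  rw [hx, Pi.zero_apply, nnnorm_zero] at h
  exact h.not_ge zero_le

lemma weakL1Norm_smul_le (c : ℂ) (f : Rn n →ₘ[volume] ℂ) :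
    weakL1Norm (c • f) ≤ ‖c‖ₑ * weakL1Norm f := by
  rcases eq_or_ne c 0 with rfl | hc
  · rw [zero_smul ℂ f, weakL1Norm_zero]
    exact zero_le
  have hc' : 0 < ‖c‖₊ := nnnorm_pos.2 hc
  refine weakL1Norm_le_iff.2 fun t => ?_
  have hset : {x | t < ‖(c • f) x‖₊} =ᵐ[volume] {x | t / ‖c‖₊ < ‖f x‖₊} := by
    filter_upwards [AEEqFun.coeFn_smul c f] with x hx
    refine propext ?_
    change t < ‖(c • f) x‖₊ ↔ t / ‖c‖₊ < ‖f x‖₊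
    rw [hx, Pi.smul_apply, nnnorm_smul, div_lt_iff₀' hc']
  calc (t : ℝ≥0∞) * volume {x | t < ‖(c • f) x‖₊}
      = ‖c‖ₑ * (((t / ‖c‖₊ : ℝ≥0) : ℝ≥0∞) * volume {x | t / ‖c‖₊ < ‖f x‖₊}) := by
        rw [measure_congr hset, ← mul_assoc, enorm_eq_nnnorm, ← ENNReal.coe_mul,
          mul_div_cancel₀ t hc'.ne']
    _ ≤ _ := mul_le_mul_right (mul_volume_le_weakL1Norm _ _) _

lemma eq_zero_of_weakL1Norm_eq_zero {f : Rn n →ₘ[volume] ℂ} (h : weakL1Norm f = 0) : f = 0 := by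
  have h1 : ∀ k : ℕ, volume {x | (1 / ((k : ℝ≥0) + 1)) < ‖f x‖₊} = 0 := fun k => by
    have h2 := mul_volume_le_weakL1Norm f (1 / ((k : ℝ≥0) + 1))
    rw [h, nonpos_iff_eq_zero, mul_eq_zero] at h2
    refine h2.resolve_left ?_
    exact ENNReal.coe_ne_zero.2 (by positivity)
  refine AEEqFun.ext ?_
  have h2 : ∀ᵐ x, ∀ k : ℕ, ¬ (1 / ((k : ℝ≥0) + 1)) < ‖f x‖₊ :=
    ae_all_iff.2 fun k => measure_eq_zero_iff_ae_notMem.1 (h1 k)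
  filter_upwards [h2, AEEqFun.coeFn_zero (α := Rn n) (β := ℂ) (μ := volume)] with x hx h0
  rw [h0, Pi.zero_apply]
  by_contra hne
  obtain ⟨k, hk⟩ := exists_nat_one_div_lt (norm_pos_iff.2 hne)
  exact hx k (by exact_mod_cast hk)

end weakL1Norm

/-! ### Extension to L¹ and L^p -/

/-- Functions in `L²` are dense among those in `L^p`. -/
lemma exists_L2_eLpNorm_sub_le {p : ℝ≥0∞} (hp1 : 1 ≤ p) (hp : p ≠ ∞) {f : Rn n → ℂ}
    (hf : MemLp f p) {ε : ℝ} (hε : 0 < ε) :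
    ∃ g : L2 n, MemLp g p ∧ eLpNorm (f - (g : Rn n → ℂ)) p ≤ ENNReal.ofReal ε := by
  obtain ⟨g, hgc, hg, hfg⟩ := hf.exist_eLpNorm_sub_le hp hp1 hε
  have hgL : ∀ q, MemLp g q := fun q => hg.continuous.memLp_of_hasCompactSupport hgc
  have hae : (hgL 2).toLp g =ᵐ[volume] g := (hgL 2).coeFn_toLp
  refine ⟨(hgL 2).toLp g, (memLp_congr_ae hae).2 (hgL p), le_trans (le_of_eq ?_) hfg⟩
  exact eLpNorm_congr_ae ((ae_eq_refl f).sub hae)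

lemma lintegral_enorm_sub_eq_eLpNorm (f g : Rn n → ℂ) :
    ∫⁻ x, ‖f x - g x‖ₑ = eLpNorm (f - g) 1 := by
  rw [eLpNorm_one_eq_lintegral_enorm]; rfl

lemma exists_L2_lintegral_sub_le (f : Lp ℂ 1 (volume : Measure (Rn n))) {ε : ℝ} (hε : 0 < ε) :
    ∃ g : L2 n, Integrable g ∧ ∫⁻ x, ‖f x - g x‖ₑ ≤ ENNReal.ofReal ε := by
  obtain ⟨g, hg, hfg⟩ := exists_L2_eLpNorm_sub_le le_rfl ENNReal.one_ne_top (Lp.memLp f) hε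
  exact ⟨g, memLp_one_iff_integrable.1 hg, by rwa [lintegral_enorm_sub_eq_eLpNorm]⟩

/-- `h` is the value at `f ∈ L¹` of the extension of `S`, as its distance in `L^{1,∞}` to the values
of `S` is controlled. -/
def IsWeakValue (S : L2 n →L[ℂ] L2 n) (C : ℝ≥0) (f : Lp ℂ 1 (volume : Measure (Rn n)))
    (h : Rn n →ₘ[volume] ℂ) : Prop :=
  ∀ g : L2 n, Integrable g → weakL1Norm (h - (S g : Rn n →ₘ[volume] ℂ)) ≤ C * ∫⁻ x, ‖f x - g x‖ₑ

lemma HasWeakType.mul_volume_sub_le {S : L2 n →L[ℂ] L2 n} {C : ℝ≥0} (hS : HasWeakType S C)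
    {f g : L2 n} (hf : Integrable f) (hg : Integrable g) (t : ℝ≥0) :
    t * volume {x | t < ‖S f x - S g x‖₊} ≤ C * ∫⁻ x, ‖f x - g x‖ₑ := by
  have h := hS (f - g) ((hf.sub hg).congr (Lp.coeFn_sub f g).symm) t
  refine (le_of_eq ?_).trans (h.trans_eq ?_)
  · congr 1
    refine measure_congr ?_
    filter_upwards [Lp.coeFn_sub (S f) (S g)] with x hx
    refine propext ?_
    change t < ‖S f x - S g x‖₊ ↔ t < ‖S (f - g) x‖₊
    rw [map_sub, hx, Pi.sub_apply]
  · congr 1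
    refine lintegral_congr_ae ?_
    filter_upwards [Lp.coeFn_sub f g] with x hx
    rw [hx, Pi.sub_apply]

lemma lintegral_enorm_sub_triangle {f g h : Rn n → ℂ} (hf : AEStronglyMeasurable f)
    (hg : AEStronglyMeasurable g) :
    ∫⁻ x, ‖f x - h x‖ₑ ≤ (∫⁻ x, ‖g x - f x‖ₑ) + ∫⁻ x, ‖g x - h x‖ₑ := by
  rw [← lintegral_add_left' (f := fun x => ‖g x - f x‖ₑ) (hg.sub hf).enorm]
  refine lintegral_mono fun x => ?_
  rw [← sub_sub_sub_cancel_left (h x) (f x) (g x), sub_sub_sub_cancel_left,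
    ← sub_add_sub_cancel (f x) (g x) (h x)]
  exact (enorm_add_le _ _).trans_eq (by
    rw [← enorm_neg (f x - g x), neg_sub])

/-- Rapid approximation in `L¹` makes the values converge almost everywhere. -/
lemma HasWeakType.ae_exists_tendsto {S : L2 n →L[ℂ] L2 n} {C : ℝ≥0} (hS : HasWeakType S C)
    {f : Rn n → ℂ} (hf : AEStronglyMeasurable f) {g : ℕ → L2 n} (hg : ∀ k, Integrable (g k))
    (hfg : ∀ k, ∫⁻ x, ‖f x - g k x‖ₑ ≤ ENNReal.ofReal ((1 / 4) ^ k)) :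
    ∀ᵐ x, ∃ l, Filter.Tendsto (fun k => S (g k) x) Filter.atTop (nhds l) := by
  -- L¹ errors of order 4^{-k} tested at height 2^{-k} leave measures of order 2^{-k}. These are
  -- summable, so by Borel–Cantelli the increments are eventually at most 2^{-k} almost everywhere.
  have hvol : ∀ k, volume {x | (1 / 2 : ℝ≥0) ^ k < ‖S (g (k + 1)) x - S (g k) x‖₊} ≤
      2 * C * ENNReal.ofReal ((1 / 2) ^ k) := by
    intro k
    have h1 := hS.mul_volume_sub_le (hg (k + 1)) (hg k) ((1 / 2) ^ k)
    have h2 : ∫⁻ x, ‖g (k + 1) x - g k x‖ₑ ≤ 2 * ENNReal.ofReal ((1 / 4) ^ k) := by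
      refine (lintegral_enorm_sub_triangle (hg (k + 1)).aestronglyMeasurable hf).trans ?_
      rw [two_mul]
      refine add_le_add ((hfg (k + 1)).trans (ENNReal.ofReal_le_ofReal ?_)) (hfg k)
      exact pow_le_pow_of_le_one (by norm_num) (by norm_num) (Nat.le_succ k)
    have h0 : (((1 / 2 : ℝ≥0) ^ k : ℝ≥0) : ℝ≥0∞) ≠ 0 := ENNReal.coe_ne_zero.2 (by positivity)
    rw [← ENNReal.mul_le_mul_iff_right h0 ENNReal.coe_ne_top]
    refine h1.trans ((mul_le_mul_right h2 _).trans_eq ?_)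
    have e : (((1 / 2 : ℝ≥0) ^ k : ℝ≥0) : ℝ≥0∞) = ENNReal.ofReal ((1 / 2) ^ k) := by
      rw [← ENNReal.ofReal_coe_nnreal]; norm_num
    have e' : ENNReal.ofReal ((1 / 4) ^ k) =
        ENNReal.ofReal ((1 / 2) ^ k) * ENNReal.ofReal ((1 / 2) ^ k) := by
      rw [← ENNReal.ofReal_mul (by positivity), ← mul_pow]
      norm_num
    rw [e, e']
    ring
  have hsum : ∑' k, volume {x | (1 / 2 : ℝ≥0) ^ k < ‖S (g (k + 1)) x - S (g k) x‖₊} ≠ ∞ := by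
    refine ((ENNReal.tsum_le_tsum hvol).trans_lt ?_).ne
    rw [ENNReal.tsum_mul_left, ← ENNReal.ofReal_tsum_of_nonneg (fun k => by positivity)
      (summable_geometric_of_lt_one (by norm_num) (by norm_num))]
    exact ENNReal.mul_lt_top (ENNReal.mul_lt_top (by norm_num) ENNReal.coe_lt_top)
      ENNReal.ofReal_lt_top
  filter_upwards [ae_eventually_notMem hsum] with x hx
  refine cauchySeq_tendsto_of_complete (cauchySeq_of_summable_dist ?_)
  refine Summable.of_norm_bounded_eventually_nat (g := fun k => (1 / 2 : ℝ) ^ k)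
    (summable_geometric_of_lt_one (by norm_num) (by norm_num)) ?_
  filter_upwards [hx] with k hk
  have hk' : ‖S (g (k + 1)) x - S (g k) x‖₊ ≤ (1 / 2 : ℝ≥0) ^ k := not_lt.1 hk
  rw [Real.norm_of_nonneg dist_nonneg, dist_comm, dist_eq_norm]
  exact_mod_cast hk'

/-- The value is the almost everywhere limit of S gₖ for gₖ → f fast in L¹; the weak estimate for S
gₖ - S u survives the limit by a Fatou argument on level sets. -/
lemma HasWeakType.exists_isWeakValue {S : L2 n →L[ℂ] L2 n} {C : ℝ≥0} (hS : HasWeakType S C)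
    (f : Lp ℂ 1 (volume : Measure (Rn n))) : ∃ h, IsWeakValue S C f h := by
  have hfm : AEStronglyMeasurable f := (Lp.memLp f).aestronglyMeasurable
  choose g hg hfg using fun k : ℕ =>
    exists_L2_lintegral_sub_le f (show (0 : ℝ) < (1 / 4) ^ k by positivity)
  obtain ⟨h, hhm, hlim⟩ := exists_stronglyMeasurable_limit_of_tendsto_ae
    (fun k => (Lp.memLp (S (g k))).aestronglyMeasurable) (hS.ae_exists_tendsto hfm hg hfg)
  set H : Rn n →ₘ[volume] ℂ := AEEqFun.mk h hhm.aestronglyMeasurable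
  refine ⟨H, fun u hu => weakL1Norm_le_iff.2 fun t => ?_⟩
  -- Where the limit exceeds t in modulus, so do all late terms: the level set lies, up to a null
  -- set, in the increasing union of the V m.
  set V : ℕ → Set (Rn n) := fun m => {x | ∀ k ≥ m, t < ‖S (g k) x - S u x‖₊} with hV
  have hVmono : Monotone V := fun i j hij x hx k hk => hx k (hij.trans hk)
  have hVle : ∀ m, t * volume (V m) ≤ C * ∫⁻ x, ‖f x - u x‖ₑ := by
    intro m
    have hlim0 : Filter.Tendsto (fun k : ℕ => C * (ENNReal.ofReal ((1 / 4) ^ k) +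
        ∫⁻ x, ‖f x - u x‖ₑ)) Filter.atTop (nhds (C * (0 + ∫⁻ x, ‖f x - u x‖ₑ))) := by
      refine ENNReal.Tendsto.const_mul (Filter.Tendsto.add ?_ tendsto_const_nhds)
        (Or.inr ENNReal.coe_ne_top)
      rw [← ENNReal.ofReal_zero]
      exact ENNReal.tendsto_ofReal
        (tendsto_pow_atTop_nhds_zero_of_lt_one (by norm_num) (by norm_num))
    rw [zero_add] at hlim0
    refine ge_of_tendsto hlim0 ((Filter.eventually_ge_atTop m).mono fun k hk => ?_)
    calc t * volume (V m) ≤ t * volume {x | t < ‖S (g k) x - S u x‖₊} := by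
          gcongr
          exact fun x hx => hx k hk
      _ ≤ C * ∫⁻ x, ‖g k x - u x‖ₑ := hS.mul_volume_sub_le (hg k) hu t
      _ ≤ _ := mul_le_mul_right ((lintegral_enorm_sub_triangle
          (hg k).aestronglyMeasurable hfm).trans (add_le_add (hfg k) le_rfl)) _
  have hcover : {x | t < ‖(H - (S u : Rn n →ₘ[volume] ℂ) : Rn n →ₘ[volume] ℂ) x‖₊}
      ≤ᵐ[volume] (⋃ m, V m : Set (Rn n)) := by
    filter_upwards [AEEqFun.coeFn_sub H (S u : Rn n →ₘ[volume] ℂ),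
      AEEqFun.coeFn_mk h hhm.aestronglyMeasurable, hlim] with x h1 h2 h3 hxt
    have h4 : t < ‖(H - (S u : Rn n →ₘ[volume] ℂ) : Rn n →ₘ[volume] ℂ) x‖₊ := hxt
    rw [h1, Pi.sub_apply, h2] at h4
    have h5 := ((h3.sub_const (S u x)).nnnorm).eventually_const_lt h4
    obtain ⟨m, hm⟩ := Filter.eventually_atTop.1 h5
    exact Set.mem_iUnion.2 ⟨m, hm⟩
  refine (mul_le_mul_right (measure_mono_ae hcover) _).trans ?_
  rw [hVmono.measure_iUnion, ENNReal.mul_iSup]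
  exact iSup_le hVle

lemma ennreal_eq_zero_of_forall_le_mul {a B : ℝ≥0∞} (hB : B ≠ ∞)
    (h : ∀ ε : ℝ, 0 < ε → a ≤ B * ENNReal.ofReal ε) : a = 0 := by
  have hlim : Filter.Tendsto (fun k : ℕ => B * ENNReal.ofReal (1 / ((k : ℝ) + 1))) Filter.atTop
      (nhds (B * 0)) := by
    refine ENNReal.Tendsto.const_mul ?_ (Or.inr hB)
    rw [← ENNReal.ofReal_zero]
    exact ENNReal.tendsto_ofReal tendsto_one_div_add_atTop_nhds_zero_nat
  rw [mul_zero] at hlim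
  exact le_antisymm (ge_of_tendsto' hlim fun k => h _ Nat.one_div_pos_of_nat) zero_le

/-- S is linear on the L² approximants, so h - (h₁ + h₂) has quasi-norm O(ε). As this holds for any
weak values, arbitrarily chosen ones already form an additive map. -/
lemma IsWeakValue.add {S : L2 n →L[ℂ] L2 n} {C : ℝ≥0} {f₁ f₂ : Lp ℂ 1 (volume : Measure (Rn n))}
    {h₁ h₂ h : Rn n →ₘ[volume] ℂ} (H₁ : IsWeakValue S C f₁ h₁) (H₂ : IsWeakValue S C f₂ h₂)
    (H : IsWeakValue S C (f₁ + f₂) h) : h = h₁ + h₂ := by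
  refine sub_eq_zero.1 (eq_zero_of_weakL1Norm_eq_zero
    -- 12 = 2(2 + 2·2): two quasi-triangle inequalities, with distance 2ε for g₁ + g₂ and ε for each
    -- of g₁ and g₂.
    (ennreal_eq_zero_of_forall_le_mul (B := 12 * C) (by finiteness) fun ε hε => ?_))
  obtain ⟨g₁, hg₁, hfg₁⟩ := exists_L2_lintegral_sub_le f₁ hε
  obtain ⟨g₂, hg₂, hfg₂⟩ := exists_L2_lintegral_sub_le f₂ hε
  have hint : Integrable (g₁ + g₂ : L2 n) := (hg₁.add hg₂).congr (Lp.coeFn_add g₁ g₂).symm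
  have hle : ∫⁻ x, ‖(f₁ + f₂) x - (g₁ + g₂ : L2 n) x‖ₑ ≤
      ENNReal.ofReal ε + ENNReal.ofReal ε := by
    refine le_trans ?_ (add_le_add hfg₁ hfg₂)
    rw [← lintegral_add_left' (f := fun x => ‖f₁ x - g₁ x‖ₑ)
      ((Lp.memLp f₁).aestronglyMeasurable.sub hg₁.aestronglyMeasurable).enorm]
    refine lintegral_mono_ae ?_
    filter_upwards [Lp.coeFn_add f₁ f₂, Lp.coeFn_add g₁ g₂] with x e1 e2
    rw [e1, e2, Pi.add_apply, Pi.add_apply, add_sub_add_comm]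
    exact enorm_add_le _ _
  have hdec : h - (h₁ + h₂) = (h - (S (g₁ + g₂) : Rn n →ₘ[volume] ℂ)) -
      ((h₁ - (S g₁ : Rn n →ₘ[volume] ℂ)) + (h₂ - (S g₂ : Rn n →ₘ[volume] ℂ))) := by
    rw [map_add, AddSubgroup.coe_add]; abel
  rw [hdec]
  calc _ ≤ 2 * (weakL1Norm (h - (S (g₁ + g₂) : Rn n →ₘ[volume] ℂ)) +
        2 * (weakL1Norm (h₁ - (S g₁ : Rn n →ₘ[volume] ℂ)) +
          weakL1Norm (h₂ - (S g₂ : Rn n →ₘ[volume] ℂ)))) :=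
        (weakL1Norm_sub_le _ _).trans (by gcongr; exact weakL1Norm_add_le _ _)
    _ ≤ 2 * (C * (ENNReal.ofReal ε + ENNReal.ofReal ε) +
        2 * (C * ENNReal.ofReal ε + C * ENNReal.ofReal ε)) := by
        gcongr
        · exact (H _ hint).trans (mul_le_mul_right hle _)
        · exact (H₁ _ hg₁).trans (mul_le_mul_right hfg₁ _)
        · exact (H₂ _ hg₂).trans (mul_le_mul_right hfg₂ _)
    _ = _ := by ring

lemma IsWeakValue.smul {S : L2 n →L[ℂ] L2 n} {C : ℝ≥0} {f : Lp ℂ 1 (volume : Measure (Rn n))}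
    {c : ℂ} {h₁ h : Rn n →ₘ[volume] ℂ} (H₁ : IsWeakValue S C f h₁)
    (H : IsWeakValue S C (c • f) h) : h = c • h₁ := by
  refine sub_eq_zero.1 (eq_zero_of_weakL1Norm_eq_zero
    (ennreal_eq_zero_of_forall_le_mul (B := 4 * ‖c‖ₑ * C) (by finiteness) fun ε hε => ?_))
  obtain ⟨g, hg, hfg⟩ := exists_L2_lintegral_sub_le f hε
  have hint : Integrable (c • g : L2 n) := (hg.smul c).congr (Lp.coeFn_smul c g).symm
  have hle : ∫⁻ x, ‖(c • f) x - (c • g : L2 n) x‖ₑ ≤ ‖c‖ₑ * ENNReal.ofReal ε := by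
    refine le_trans (le_of_eq ?_) (mul_le_mul_right hfg _)
    rw [← lintegral_const_mul' _ _ enorm_ne_top]
    refine lintegral_congr_ae ?_
    filter_upwards [Lp.coeFn_smul c f, Lp.coeFn_smul c g] with x e1 e2
    rw [e1, e2, Pi.smul_apply, Pi.smul_apply, ← smul_sub, enorm_smul]
  have hdec : h - c • h₁ = (h - (S (c • g) : Rn n →ₘ[volume] ℂ)) -
      c • (h₁ - (S g : Rn n →ₘ[volume] ℂ)) := by
    rw [map_smul, smul_sub, show ((c • S g : L2 n) : Rn n →ₘ[volume] ℂ) = c • (S g).1 from rfl]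
    abel
  rw [hdec]
  calc _ ≤ 2 * (weakL1Norm (h - (S (c • g) : Rn n →ₘ[volume] ℂ)) +
        ‖c‖ₑ * weakL1Norm (h₁ - (S g : Rn n →ₘ[volume] ℂ))) :=
        (weakL1Norm_sub_le _ _).trans (by gcongr; exact weakL1Norm_smul_le _ _)
    _ ≤ 2 * (C * (‖c‖ₑ * ENNReal.ofReal ε) + ‖c‖ₑ * (C * ENNReal.ofReal ε)) := by
        gcongr
        · exact (H _ hint).trans (mul_le_mul_right hle _)
        · exact (H₁ _ hg).trans (mul_le_mul_right hfg _)
    _ = _ := by ring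

/-- Testing against f itself makes the right side of the defining inequality zero. -/
lemma IsWeakValue.eq_apply {S : L2 n →L[ℂ] L2 n} {C : ℝ≥0} {f : Lp ℂ 1 (volume : Measure (Rn n))}
    {h : Rn n →ₘ[volume] ℂ} (H : IsWeakValue S C f h) {g : L2 n}
    (hfg : (f : Rn n →ₘ[volume] ℂ) = g) : h = S g := by
  have hg : Integrable g := by
    have := memLp_one_iff_integrable.1 (Lp.memLp f)
    rwa [hfg] at this
  refine sub_eq_zero.1 (eq_zero_of_weakL1Norm_eq_zero (le_antisymm ((H g hg).trans ?_) zero_le))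
  simp [hfg]

/-- An operator of weak type `(1, 1)` extends to `L¹`. -/
theorem HasWeakType.exists_extension {S : L2 n →L[ℂ] L2 n} {C : ℝ≥0} (hS : HasWeakType S C) :
    ∃ T₁ : Lp ℂ 1 (volume : Measure (Rn n)) →ₗ[ℂ] (Rn n →ₘ[volume] ℂ),
      (∀ (f : Lp ℂ 1 (volume : Measure (Rn n))) (g : L2 n),
        (f : Rn n →ₘ[volume] ℂ) = g → T₁ f = S g) ∧ ∀ f, weakL1Norm (T₁ f) ≤ C * ‖f‖ₑ := by
  choose T₁ hT₁ using fun f => hS.exists_isWeakValue f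
  refine ⟨{ toFun := T₁
            map_add' := fun f g => (hT₁ f).add (hT₁ g) (hT₁ (f + g))
            map_smul' := fun c f => (hT₁ f).smul (hT₁ (c • f)) },
    fun f g hfg => (hT₁ f).eq_apply hfg, fun f => ?_⟩
  have h0 : (0 : L2 n) =ᵐ[volume] (0 : Rn n → ℂ) := Lp.coeFn_zero _ _ _
  -- Comparison with g = 0 turns the defining inequality into the weak (1,1) bound.
  have h := hT₁ f 0 ((integrable_zero _ _ _).congr h0.symm)
  rw [show ((S 0 : L2 n) : Rn n →ₘ[volume] ℂ) = 0 by rw [map_zero]; rfl, sub_zero] at h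
  refine h.trans_eq ?_
  rw [Lp.enorm_def, eLpNorm_one_eq_lintegral_enorm]
  congr 1
  refine lintegral_congr_ae ?_
  filter_upwards [h0] with x hx
  rw [hx, Pi.zero_apply, sub_zero]

/-- A bounded operator for the `L^p` norm on `L^p ∩ L²` extends to `L^p`. -/
theorem HasStrongType.exists_extension {S : L2 n →L[ℂ] L2 n} {C : ℝ≥0} {p : ℝ≥0∞} (hp1 : 1 ≤ p)
    (hp : p ≠ ∞) (hS : HasStrongType S p C) :
    ∃ Tp : Lp ℂ p (volume : Measure (Rn n)) →ₗ[ℂ] Lp ℂ p (volume : Measure (Rn n)),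
      (∀ (f : Lp ℂ p (volume : Measure (Rn n))) (g : L2 n),
        (f : Rn n →ₘ[volume] ℂ) = g → (Tp f : Rn n →ₘ[volume] ℂ) = S g) ∧
      ∀ f, ‖Tp f‖ ≤ C * ‖f‖ := by
  have : Fact (1 ≤ p) := ⟨hp1⟩
  let V : Submodule ℂ (L2 n) :=
    { carrier := {g | MemLp g p volume}
      add_mem' := fun {g h} hg hh => (memLp_congr_ae (Lp.coeFn_add g h)).2 (hg.add hh)
      zero_mem' := (memLp_congr_ae (Lp.coeFn_zero ℂ 2 volume)).2 MemLp.zero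
      smul_mem' := fun c g hg => (memLp_congr_ae (Lp.coeFn_smul c g)).2 (hg.const_smul c) }
  have hmem : ∀ g : V, MemLp (g : L2 n) p := fun g => g.2
  have hSmem : ∀ g : V, MemLp (S g) p := fun g =>
    ⟨(Lp.memLp (S (g : L2 n))).aestronglyMeasurable, (hS g (hmem g)).trans_lt
      (ENNReal.mul_lt_top ENNReal.coe_lt_top (hmem g).eLpNorm_lt_top)⟩
  -- V is L² ∩ L^p inside L², and `e` reads it in L^p, where its range is dense; `F` is S read in
  -- L^p, and it is bounded relative to `e`.
  let e : V →ₗ[ℂ] Lp ℂ p (volume : Measure (Rn n)) :=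
    { toFun := fun g => ⟨(g : L2 n), Lp.mem_Lp_iff_memLp.2 (hmem g)⟩
      map_add' := fun g h => rfl
      map_smul' := fun c g => rfl }
  let F : V →ₗ[ℂ] Lp ℂ p (volume : Measure (Rn n)) :=
    { toFun := fun g => ⟨S (g : L2 n), Lp.mem_Lp_iff_memLp.2 (hSmem g)⟩
      map_add' := fun g h => Subtype.ext (by simp)
      map_smul' := fun c g => Subtype.ext 
        (congrArg (fun u : L2 n => (u : Rn n →ₘ[volume] ℂ)) (S.map_smul c (g : L2 n))) }
  have hdense : DenseRange e := by
    refine Metric.dense_iff.2 fun f ε hε => ?_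
    obtain ⟨g, hg, hfg⟩ := exists_L2_eLpNorm_sub_le hp1 hp (Lp.memLp f) (half_pos hε)
    refine ⟨e ⟨g, hg⟩, ?_, ⟨g, hg⟩, rfl⟩
    rw [Metric.mem_ball, dist_comm, Lp.dist_def]
    exact (ENNReal.toReal_le_of_le_ofReal (half_pos hε).le hfg).trans_lt (half_lt_self hε)
  have hbound : ∀ g, ‖F g‖ ≤ C * ‖e g‖ := fun g => by
    rw [Lp.norm_def, Lp.norm_def, ← ENNReal.coe_toReal C, ← ENNReal.toReal_mul]
    exact ENNReal.toReal_mono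
      (ENNReal.mul_ne_top ENNReal.coe_ne_top (hmem g).eLpNorm_ne_top) (hS g (hmem g))
  refine ⟨F.extendOfNorm e, fun f g hfg => ?_,
    LinearMap.norm_extendOfNorm_apply_le hdense C hbound⟩
  have hg : MemLp g p := by
    have := Lp.memLp f
    rwa [hfg] at this
  have hf : f = e ⟨g, hg⟩ := Subtype.ext hfg
  rw [hf]
  exact congrArg _ (LinearMap.extendOfNorm_eq hdense ⟨C, hbound⟩ ⟨g, hg⟩)

end CZGamma

/-! ### The main theorem -/

theorem theorem3 {n : ℕ} (hn : 0 < n) (Γ : CZGamma.StandardHyperCurve n)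
    (T : CZGamma.TestFn n →L[ℂ] CZGamma.Distr n) (hT : CZGamma.IsCZO Γ T)
    (T₂ : Lp ℂ 2 (volume : Measure (CZGamma.Rn n)) →L[ℂ]
      Lp ℂ 2 (volume : Measure (CZGamma.Rn n)))
    (hT₂ : CZGamma.IsL2Extension T T₂) :
    -- the extension of `T` to `L¹`
    ∃ T₁ : Lp ℂ 1 (volume : Measure (CZGamma.Rn n)) →ₗ[ℂ] (CZGamma.Rn n →ₘ[volume] ℂ),
      (∀ (f : Lp ℂ 1 (volume : Measure (CZGamma.Rn n)))
        (g : Lp ℂ 2 (volume : Measure (CZGamma.Rn n))),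
        (f : CZGamma.Rn n →ₘ[volume] ℂ) = g → T₁ f = T₂ g) ∧
      ∀ p : ℝ≥0∞, 1 < p → p < ⊤ →
        -- the extension of `T` to `L^p`
        ∃ Tp : Lp ℂ p (volume : Measure (CZGamma.Rn n)) →ₗ[ℂ]
            Lp ℂ p (volume : Measure (CZGamma.Rn n)),
          (∀ (f : Lp ℂ p (volume : Measure (CZGamma.Rn n)))
            (g : Lp ℂ 2 (volume : Measure (CZGamma.Rn n))),
            (f : CZGamma.Rn n →ₘ[volume] ℂ) = g → (Tp f : CZGamma.Rn n →ₘ[volume] ℂ) = T₂ g) ∧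
          ∃ C : ℝ≥0, 0 < C ∧
            (∀ f, CZGamma.weakL1Norm (T₁ f) ≤ C * ‖f‖ₑ) ∧
            (∀ f, ‖Tp f‖ ≤ C * ‖f‖) := by
  obtain ⟨T₂', hT₂', K, hK, -, hrep⟩ := hT
  -- The kernel representation is stated for the extension supplied by `IsCZO`; uniqueness
  -- identifies it with the given one.
  obtain rfl := hT₂.unique hT₂'
  obtain ⟨A, δ, hK⟩ := hK.exists_kernelBounds
  obtain ⟨M, hM⟩ := hK.exists_hasAtomicDecay hrep
  obtain ⟨M', hM'⟩ := hK.exists_hasAtomicDecay_adjoint hrep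
  obtain ⟨C, hC⟩ := hM.exists_hasWeakType hn
  obtain ⟨C', hC'⟩ := hM'.exists_hasWeakType hn
  obtain ⟨T₁, hT₁, hT₁C⟩ := hC.exists_extension
  -- The L¹ extension is fixed before p is introduced, hence independent of p.
  refine ⟨T₁, hT₁, fun p hp1 hp => ?_⟩
  obtain ⟨D, hD⟩ := CZGamma.exists_hasStrongType hC hC' hp1 hp
  obtain ⟨Tp, hTp, hTpD⟩ := hD.exists_extension hp1.le hp.ne
  -- One constant dominating both bounds; the summand 1 makes it positive.
  refine ⟨Tp, hTp, C + D + 1, by positivity, fun f => (hT₁C f).trans ?_, fun f => (hTpD f).trans ?_⟩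
  · gcongr
    exact (le_add_of_nonneg_right zero_le).trans (le_add_of_nonneg_right zero_le)
  · rw [Lp.norm_def]
    push_cast
    gcongr
    linarith [C.coe_nonneg]
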